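/- Fix constants $0<\kappa_1\le\kappa_2<\infty$ and $m>0$. For every $n\ge 1$ let $\{\mathbf y_t\}_{t\in\mathbb Z}$ be a strictly stationary $p$-dimensional VAR(1) process $\mathbf y_t=A\mathbf y_{t-1}+\mathbf e_t$ $(t\in\mathbb Z)$, where the $\mathbf e_t$ are i.i.d. $\mathcal N_p(\mathbf 0,\Sigma_{\mathbf e})$ and the process is stable, that is, all complex eigenvalues of $A$ have modulus less than $1$. The dimension $p=p_n\ge 1$ (which may exceed $n$), the matrices $A=A_n$ and $\Sigma_{\mathbf e}=\Sigma_{\mathbf e,n}$, and the underlying probability space may all depend on $n$, but the dependence structure is controlled uniformly in $n$: all eigenvalues of $\Sigma_{\mathbf e}$ lie in $[\kappa_1,\kappa_2]$, and for every $z\in\mathbb C$ with $|z|=1$ the smallest eigenvalue of $(I-zA)^*(I-zA)$ is at least $m$. Let $\mathbf X=(\mathbf y_0,\dots,\mathbf y_{n-1})^{\mathsf T}\in\mathbb R^{n\times p}$ be the lagged design matrix, let $s_i$ be the number of nonzero entries in the $i$-th row of $A$, and let $\|v\|_0$ be the number of nonzero coordinates of a vector $v$. Then there are constants $0<c_*<c^*<\infty$,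 depending only on $\kappa_1,\kappa_2,m$, such that the following holds for every such sequence of models. For every choice of row indices $i=i_n\in\{1,\dots,p_n\}$ with $$\frac{s_i\log p}{\sqrt n}\to 0\qquad(n\to\infty)$$ and every sequence of nonnegative integers $s_R=s_{R,n}$ with $s_R=O(s_i)$ (that is, $s_R\le K s_i$ for some constant $K$ and all large $n$), $$\mathbb P\Big(c_*\le \tfrac1n\|\mathbf Xv\|_2^2\le c^*\ \text{ for all } v\in\mathbb R^p \text{ with } \|v\|_2=1,\ \|v\|_0\le s_R\Big)\to 1\qquad(n\to\infty).$$ -/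

import Mathlib

open MeasureTheory ProbabilityTheory Filter Topology Asymptotics
open scoped Matrix ComplexOrder

namespace SparseVAR

/-- The complexification of a real matrix. -/
def complexify {p : ℕ} (A : Matrix (Fin p) (Fin p) ℝ) : Matrix (Fin p) (Fin p) ℂ :=
  A.map (fun x : ℝ => (x : ℂ))

/-- The VAR(1) model with transition matrix `A` is stable: every (complex) eigenvalue of `A` has
modulus smaller than one. -/
def IsStable {p : ℕ} (A : Matrix (Fin p) (Fin p) ℝ) : Prop :=
  ∀ z ∈ spectrum ℂ (complexify A), ‖z‖ < 1

/-- The value `I - z A` at `z` of the reverse characteristic polynomial of the VAR(1) model. -/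
def charPoly {p : ℕ} (A : Matrix (Fin p) (Fin p) ℝ) (z : ℂ) : Matrix (Fin p) (Fin p) ℂ :=
  1 - z • complexify A

/-- The dependence parameters of the model are controlled by `κ₁`, `κ₂`, `m`: all eigenvalues of
the noise covariance `S` lie in `[κ₁, κ₂]`, and for all complex `z` of modulus one the smallest
eigenvalue of `(I - z A)ᴴ (I - z A)` is at least `m`. The bounds on eigenvalues are written in the
Loewner order. -/
structure DependenceBounds {p : ℕ} (κ₁ κ₂ m : ℝ) (A S : Matrix (Fin p) (Fin p) ℝ) : Prop where
  noise_lower : (S - κ₁ • (1 : Matrix (Fin p) (Fin p) ℝ)).PosSemidef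
  noise_upper : (κ₂ • (1 : Matrix (Fin p) (Fin p) ℝ) - S).PosSemidef
  char_lower : ∀ z : ℂ, ‖z‖ = 1 →
    ((charPoly A z)ᴴ * charPoly A z - (m : ℂ) • (1 : Matrix (Fin p) (Fin p) ℂ)).PosSemidef

/-- `y` is a (strictly stationary) stable Gaussian VAR(1) process with transition matrix `A` and
white noise `e`, where the `e t` are i.i.d. with law `N(0, S)`. -/
structure IsStableGaussianVAR {p : ℕ} {Ω : Type*} [MeasurableSpace Ω] (P : Measure Ω)
    (A S : Matrix (Fin p) (Fin p) ℝ) (y e : ℤ → Ω → EuclideanSpace ℝ (Fin p)) : Prop where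
  stable : IsStable A
  measurable_process : ∀ t, Measurable (y t)
  measurable_noise : ∀ t, Measurable (e t)
  noise_indep : iIndepFun e P
  noise_law : ∀ t, P.map (e t) = multivariateGaussian 0 S
  recursion : ∀ t, ∀ᵐ ω ∂P, y t ω = WithLp.toLp 2 (A *ᵥ (y (t - 1) ω).ofLp) + e t ω
  stationary : ∀ h : ℤ, P.map (fun ω (t : ℤ) => y (t + h) ω) = P.map (fun ω (t : ℤ) => y t ω)

/-- The design matrix with rows `y 0, …, y (n - 1)`, at the outcome `ω`. -/
def design {p : ℕ} {Ω : Type*} (y : ℤ → Ω → EuclideanSpace ℝ (Fin p)) (n : ℕ) (ω : Ω) :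
    Matrix (Fin n) (Fin p) ℝ :=
  Matrix.of fun t j => y (t : ℕ) ω j

/-- The number of nonzero coordinates of a vector. -/
noncomputable def l0 {p : ℕ} (v : Fin p → ℝ) : ℕ :=
  (Finset.univ.filter fun j => v j ≠ 0).card

/-- The design matrix `X`, with `n` rows, has all its quadratic forms `‖X v‖² / n` between `c` and
`C`, for unit vectors `v` with at most `s` nonzero coordinates. -/
def SparseRiesz {n p : ℕ} (X : Matrix (Fin n) (Fin p) ℝ) (s : ℕ) (c C : ℝ) : Prop :=
  ∀ v : EuclideanSpace ℝ (Fin p), l0 v.ofLp ≤ s → ‖v‖ = 1 →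
    c ≤ ‖(WithLp.toLp 2 (X *ᵥ v.ofLp) : EuclideanSpace ℝ (Fin n))‖ ^ 2 / n ∧
      ‖(WithLp.toLp 2 (X *ᵥ v.ofLp) : EuclideanSpace ℝ (Fin n))‖ ^ 2 / n ≤ C

end SparseVAR

/-!
The covariance of a truncated version of the process is bounded below by `S ≥ κ₁`, and above by
`κ₂ / m`, because the orbits of unit vectors under `Aᵀ` have energy at most `1 / m`: on the unit
circle `1 - z A` is bounded below by `√m`, and Parseval's identity for the finite Fourier transform
of an orbit turns this into a bound of `∑ k, ‖(Aᵀ) ^ k w‖ ^ 2` (`sum_norm_sq_pow_le`,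
`sum_transpose_pow_mulVec_le`).
It remains to show that the empirical second moments are uniformly close to their expectations in
sparse directions.

For `‖v‖ = 1` and `‖v‖₀ ≤ s` one has `‖v‖₁ ^ 2 ≤ s`, so that it suffices to control every entry of
the deviation matrix up to `κ₁ / (4 s)`. By polarization an entry is controlled by the quadratic
form at the vectors `e_j ± e_k`. For a fixed vector `u`, the projections `u ⬝ᵥ x t`, `t < n`, form a
Gaussian vector. The same energy bound shows that the squared Frobenius norm of its covariance
matrix is `O(n)` (`sum_sum_sq_le`), so that `∑ t, (u ⬝ᵥ x t) ^ 2` deviates from its mean by `r` with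
probability at most `4 exp (-c r / √n)` (`measure_abs_sum_sq_sub_ge_le`). This follows from the
exponential moments of the chi-square law after diagonalization. With `r` of order `n / s` and a
union bound over `2 p ^ 2` vectors, the failure probability is at most
`8 p ^ 2 exp (-b √n / s)` (`measure_not_sparseRiesz_le`), which tends to zero if
`s ≥ 1` and `s log p = o(√n)`. Nothing is to be shown if `s = 0`.

The truncated process `x` is started at time `-N - 1` from the state zero. It differs from the
process `y` at time `t` by `A ^ (t + N + 1)` applied to `y (-N - 1)`. By stationarity and stability
this tends to zero in probability as `N → ∞`, while the bounds above do not depend on `N`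
(`tendsto_measure_pow_mulVec_gt`).
-/

namespace SparseVAR

/-! ### Concentration of Gaussian sums of squares -/

/-- The exponential moment `1 / √(1 - x)` of a squared Gaussian variable, multiplied by the centring
factor, is at most Gaussian in `x`. -/
lemma sqrt_one_div_one_sub_mul_exp_le {x : ℝ} (hx : |x| ≤ 1 / 2) :
    √(1 / (1 - x)) * Real.exp (-x / 2) ≤ Real.exp (x ^ 2 / 2) := by
  have h1 := (abs_le.1 hx).1
  have h2 := (abs_le.1 hx).2
  have key : 1 ≤ (1 - x) * Real.exp (x + x ^ 2) := by
    rcases le_total 0 x with h | h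
    · have := Real.quadratic_le_exp_of_nonneg (show 0 ≤ x + x ^ 2 by positivity)
      calc (1 : ℝ) ≤ (1 - x) * (1 + (x + x ^ 2) + (x + x ^ 2) ^ 2 / 2) := by
            have h3 : 0 ≤ x ^ 2 * (1 - 2 * x) := mul_nonneg (sq_nonneg _) (by linarith)
            have h4 : 0 ≤ x ^ 3 * (1 - 2 * x) := mul_nonneg (by positivity) (by linarith)
            have h5 : 0 ≤ x ^ 4 * (1 - 2 * x) := mul_nonneg (by positivity) (by linarith)
            nlinarith [sq_nonneg x]
        _ ≤ _ := mul_le_mul_of_nonneg_left this (by linarith)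
    · have := Real.add_one_le_exp (x + x ^ 2)
      calc (1 : ℝ) ≤ (1 - x) * (x + x ^ 2 + 1) := by
            nlinarith [mul_nonneg (sq_nonneg x) (neg_nonneg.2 h)]
        _ ≤ _ := mul_le_mul_of_nonneg_left this (by linarith)
  have h3 : 1 / (1 - x) ≤ Real.exp (x + x ^ 2) := by
    rw [div_le_iff₀ (by linarith)]; linarith
  calc √(1 / (1 - x)) * Real.exp (-x / 2) ≤ √(Real.exp (x + x ^ 2)) * Real.exp (-x / 2) := by
        gcongr
    _ = Real.exp (x ^ 2 / 2) := by
        rw [Real.sqrt_eq_rpow, ← Real.exp_mul, ← Real.exp_add]; congr 1; ring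

lemma integral_exp_mul_sq_gaussianReal (v : NNReal) {l : ℝ} (h : 2 * l * v < 1) :
    ∫ x, Real.exp (l * x ^ 2) ∂(gaussianReal 0 v) = √(1 / (1 - 2 * l * v)) := by
  rcases eq_or_ne v 0 with rfl | hv
  · simp
  have hv' : (0 : ℝ) < v := by positivity
  rw [integral_gaussianReal_eq_integral_smul hv]
  have : ∀ x : ℝ, gaussianPDFReal 0 v x • Real.exp (l * x ^ 2)
      = (√(2 * Real.pi * v))⁻¹ * Real.exp (-(1 / (2 * v) - l) * x ^ 2) := by
    intro x
    rw [gaussianPDFReal_def, smul_eq_mul, mul_assoc, ← Real.exp_add]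
    congr 2; field_simp; ring
  simp_rw [this]
  rw [integral_const_mul, integral_gaussian, ← Real.sqrt_inv, ← Real.sqrt_mul (by positivity)]
  congr 1
  have h2 : 1 - 2 * l * v ≠ 0 := by linarith
  have h3 : 1 / (2 * v) - l = (1 - 2 * l * v) / (2 * v) := by field_simp
  have hpi := Real.pi_ne_zero
  rw [h3]; field_simp

lemma integrable_exp_mul_sq_gaussianReal (v : NNReal) {l : ℝ} (h : 2 * l * v < 1) :
    Integrable (fun x => Real.exp (l * x ^ 2)) (gaussianReal 0 v) := by
  -- the Bochner integral of a function that is not integrable vanishes, and this one is positive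
  apply Integrable.of_integral_ne_zero
  rw [integral_exp_mul_sq_gaussianReal v h]
  exact (Real.sqrt_pos.2 (by apply one_div_pos.2; linarith)).ne'

/-- The centred square of a Gaussian variable has a sub-Gaussian moment generating function near the
origin. -/
lemma mgf_sq_sub_le (v : NNReal) {l : ℝ} (h : |2 * l * v| ≤ 1 / 2) :
    mgf (fun x => x ^ 2 - v) (gaussianReal 0 v) l ≤ Real.exp (2 * l ^ 2 * v ^ 2) := by
  have h1 : 2 * l * v < 1 := by linarith [(abs_le.1 h).2]
  have : ∀ x : ℝ,
      Real.exp (l * (x ^ 2 - v)) = Real.exp (-(2 * l * v) / 2) * Real.exp (l * x ^ 2) := by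
    intro x; rw [← Real.exp_add]; congr 1; ring
  simp_rw [mgf, this]
  rw [integral_const_mul, integral_exp_mul_sq_gaussianReal v h1, mul_comm]
  refine (sqrt_one_div_one_sub_mul_exp_le h).trans_eq ?_
  congr 1; ring

section SumOfSquares

variable {Ω : Type*} [MeasurableSpace Ω]

lemma mgf_sq_sub_variance_le {P : Measure Ω} [IsProbabilityMeasure P] {W : Ω → ℝ} {l : ℝ}
    (hW : HasGaussianLaw W P) (h0 : P[W] = 0) (h : |2 * l * Var[W; P]| ≤ 1 / 2) :
    mgf (fun ω => W ω ^ 2 - Var[W; P]) P l ≤ Real.exp (2 * l ^ 2 * Var[W; P] ^ 2) := by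
  have hv : ((Var[W; P].toNNReal : NNReal) : ℝ) = Var[W; P] :=
    Real.coe_toNNReal _ (variance_nonneg _ _)
  have hmap : P.map W = gaussianReal 0 Var[W; P].toNNReal := by
    rw [hW.map_eq_gaussianReal, h0]
  have := mgf_sq_sub_le Var[W; P].toNNReal (l := l) (by rwa [hv])
  rw [← hmap, hv, mgf, integral_map hW.aemeasurable (by fun_prop)] at this
  exact this

lemma integrable_exp_mul_sq_sub_variance {P : Measure Ω} [IsProbabilityMeasure P] {W : Ω → ℝ}
    {l : ℝ} (hW : HasGaussianLaw W P) (h0 : P[W] = 0) (h : |2 * l * Var[W; P]| ≤ 1 / 2) :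
    Integrable (fun ω => Real.exp (l * (W ω ^ 2 - Var[W; P]))) P := by
  have hv : ((Var[W; P].toNNReal : NNReal) : ℝ) = Var[W; P] :=
    Real.coe_toNNReal _ (variance_nonneg _ _)
  have hmap : P.map W = gaussianReal 0 Var[W; P].toNNReal := by
    rw [hW.map_eq_gaussianReal, h0]
  have h1 : 2 * l * Var[W; P].toNNReal < 1 := by rw [hv]; linarith [(abs_le.1 h).2]
  have := integrable_exp_mul_sq_gaussianReal Var[W; P].toNNReal h1
  rw [← hmap, integrable_map_measure (by fun_prop) hW.aemeasurable] at this
  have h2 := this.const_mul (Real.exp (-l * Var[W; P]))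
  refine h2.congr (ae_of_all _ fun ω => ?_)
  simp only [Function.comp]
  rw [← Real.exp_add]; congr 1; ring

variable {ι : Type*} [Fintype ι]

/-- Exponential moment of a sum of squares of independent centred Gaussian variables, at an
argument that is small compared with the inverse Euclidean norm of the vector of variances. -/
lemma mgf_sum_sq_sub_variance_le {P : Measure Ω} [IsProbabilityMeasure P] {W : ι → Ω → ℝ} {l V : ℝ}
    (hWm : ∀ i, Measurable (W i))
    (hW : HasGaussianLaw (fun ω => (W · ω)) P) (h0 : ∀ i, P[W i] = 0)
    (hcov : ∀ i j, i ≠ j → cov[W i, W j; P] = 0)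
    (hV : ∑ i, Var[W i; P] ^ 2 ≤ V) (hl : 16 * l ^ 2 * V ≤ 1) :
    Integrable (fun ω => Real.exp (l * ∑ i, (W i ω ^ 2 - Var[W i; P]))) P ∧
    mgf (fun ω => ∑ i, (W i ω ^ 2 - Var[W i; P])) P l ≤ 2 := by
  have hind : iIndepFun W P := hW.iIndepFun_of_covariance_eq_zero hcov
  have hsm : ∀ i, |2 * l * Var[W i; P]| ≤ 1 / 2 := by
    intro i
    have h1 : Var[W i; P] ^ 2 ≤ V :=
      (Finset.single_le_sum (f := fun i => Var[W i; P] ^ 2) (fun _ _ => sq_nonneg _)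
        (Finset.mem_univ i)).trans hV
    apply abs_le_of_sq_le_sq _ (by norm_num)
    nlinarith [mul_le_mul_of_nonneg_left h1 (sq_nonneg l)]
  have hY : iIndepFun (fun i ω => W i ω ^ 2 - Var[W i; P]) P :=
    hind.comp (fun i x => x ^ 2 - Var[W i; P]) (fun i => by fun_prop)
  have hm : ∀ i, Measurable (fun ω => W i ω ^ 2 - Var[W i; P]) := fun i =>
    ((hWm i).pow_const 2).sub_const _
  have heq : (fun ω => ∑ i, (W i ω ^ 2 - Var[W i; P]))
      = ∑ i, fun ω => W i ω ^ 2 - Var[W i; P] := by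
    ext ω; simp
  refine ⟨?_, ?_⟩
  · have := hY.integrable_exp_mul_sum (t := l) hm (s := Finset.univ) (fun i _ =>
      integrable_exp_mul_sq_sub_variance (hW.eval i) (h0 i) (hsm i))
    simpa [Finset.sum_apply] using this
  · rw [heq, hY.mgf_sum hm]
    calc ∏ i, mgf (fun ω => W i ω ^ 2 - Var[W i; P]) P l
        ≤ ∏ i, Real.exp (2 * l ^ 2 * Var[W i; P] ^ 2) :=
          Finset.prod_le_prod (fun _ _ => mgf_nonneg) fun i _ =>
            mgf_sq_sub_variance_le (hW.eval i) (h0 i) (hsm i)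
      _ = Real.exp (2 * l ^ 2 * ∑ i, Var[W i; P] ^ 2) := by
          rw [← Real.exp_sum, Finset.mul_sum]
      _ ≤ Real.exp (1 / 8) := by
          apply Real.exp_le_exp.2
          nlinarith [mul_le_mul_of_nonneg_left hV (sq_nonneg l)]
      _ ≤ 2 := by
          have := Real.exp_bound_div_one_sub_of_interval (x := 1 / 8) (by norm_num) (by norm_num)
          norm_num at this ⊢; linarith

lemma measure_abs_sum_sq_sub_variance_ge_le {P : Measure Ω} [IsProbabilityMeasure P]
    {W : ι → Ω → ℝ} {V r : ℝ} (hWm : ∀ i, Measurable (W i))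
    (hW : HasGaussianLaw (fun ω => (W · ω)) P) (h0 : ∀ i, P[W i] = 0)
    (hcov : ∀ i j, i ≠ j → cov[W i, W j; P] = 0)
    (hVpos : 0 < V) (hV : ∑ i, Var[W i; P] ^ 2 ≤ V) :
    P.real {ω | r ≤ |∑ i, (W i ω ^ 2 - Var[W i; P])|} ≤ 4 * Real.exp (-r / (4 * √V)) := by
  set Q : Ω → ℝ := fun ω => ∑ i, (W i ω ^ 2 - Var[W i; P]) with hQ
  -- the largest argument admitted by the bound of the exponential moment
  set l : ℝ := 1 / (4 * √V) with hl
  have hl0 : 0 ≤ l := by positivity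
  have hlV : 16 * l ^ 2 * V ≤ 1 := by
    rw [hl, div_pow, mul_pow, Real.sq_sqrt hVpos.le]
    apply le_of_eq; field_simp; norm_num
  obtain ⟨hi, hb⟩ := mgf_sum_sq_sub_variance_le hWm hW h0 hcov hV hlV
  obtain ⟨hi', hb'⟩ := mgf_sum_sq_sub_variance_le (l := -l) hWm hW h0 hcov hV (by simpa using hlV)
  have e1 := measure_ge_le_exp_mul_mgf (X := Q) r hl0 hi
  have e2 := measure_le_le_exp_mul_mgf (X := Q) (t := -l) (-r) (by linarith) hi'
  have hsub : {ω | r ≤ |Q ω|} ⊆ {ω | r ≤ Q ω} ∪ {ω | Q ω ≤ -r} := by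
    intro ω hω
    rcases le_abs.1 (show r ≤ |Q ω| from hω) with h | h
    · exact Or.inl h
    · exact Or.inr (by simp only [Set.mem_ofPred_eq]; linarith)
  have hexp : Real.exp (-r / (4 * √V)) = Real.exp (-l * r) := by
    congr 1; rw [hl]; ring
  calc P.real {ω | r ≤ |Q ω|} ≤ P.real ({ω | r ≤ Q ω} ∪ {ω | Q ω ≤ -r}) := measureReal_mono hsub
    _ ≤ P.real {ω | r ≤ Q ω} + P.real {ω | Q ω ≤ -r} := measureReal_union_le _ _
    _ ≤ Real.exp (-l * r) * 2 + Real.exp (-l * r) * 2 := by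
        refine add_le_add (e1.trans ?_) (e2.trans ?_)
        · exact mul_le_mul_of_nonneg_left hb (Real.exp_pos _).le
        · rw [show - -l * -r = -l * r by ring]
          exact mul_le_mul_of_nonneg_left hb' (Real.exp_pos _).le
    _ = _ := by rw [hexp]; ring

lemma exists_orthogonal_diagonalization [DecidableEq ι] {G : Matrix ι ι ℝ} (hG : G.IsHermitian) :
    ∃ (U : Matrix ι ι ℝ) (d : ι → ℝ), U * Uᵀ = 1 ∧ Uᵀ * G * U = Matrix.diagonal d := by
  refine ⟨hG.eigenvectorUnitary, hG.eigenvalues, ?_, ?_⟩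
  · have := Unitary.coe_mul_star_self hG.eigenvectorUnitary
    simpa [Matrix.star_eq_conjTranspose] using this
  · have := hG.conjStarAlgAut_star_eigenvectorUnitary
    rw [Unitary.conjStarAlgAut_apply] at this
    simpa [Matrix.star_eq_conjTranspose] using this

/-- **Concentration of a Gaussian sum of squares.** The sum of squares of a centred Gaussian vector
deviates from its mean by more than `r` with exponentially small probability, on the scale given by
the Frobenius norm of the covariance matrix. The covariance is diagonalized by a rotation, which
turns the coordinates into independent variables and preserves the sum of squares. -/
theorem measure_abs_sum_sq_sub_ge_le {P : Measure Ω} [IsProbabilityMeasure P]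
    {Z : ι → Ω → ℝ} {V r : ℝ} (hZm : ∀ i, Measurable (Z i))
    (hZ : HasGaussianLaw (fun ω => (Z · ω)) P) (h0 : ∀ i, P[Z i] = 0)
    (hVpos : 0 < V) (hV : ∑ i, ∑ j, cov[Z i, Z j; P] ^ 2 ≤ V) :
    P.real {ω | r ≤ |∑ i, Z i ω ^ 2 - ∑ i, cov[Z i, Z i; P]|} ≤ 4 * Real.exp (-r / (4 * √V)) := by
  classical
  set G : Matrix ι ι ℝ := Matrix.of fun i j => cov[Z i, Z j; P] with hGdef
  have hG : G.IsHermitian := by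
    ext i j; simp [hGdef, covariance_comm]
  obtain ⟨U, d, hU, hd⟩ := exists_orthogonal_diagonalization hG
  have hU' : Uᵀ * U = 1 := mul_eq_one_comm.1 hU
  have hL2 : ∀ i, MemLp (Z i) 2 P := fun i => (hZ.eval i).memLp_two
  -- the coordinates of `Z` in an orthonormal eigenbasis of its covariance matrix
  set W : ι → Ω → ℝ := fun i ω => ∑ j, U j i * Z j ω with hWdef
  have hWm : ∀ i, Measurable (W i) := fun i => by
    have := hZm
    fun_prop
  have hWg : HasGaussianLaw (fun ω => (W · ω)) P := by
    have := hZ.map_fun (Matrix.mulVecLin Uᵀ).toContinuousLinearMap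
    exact this
  have hW0 : ∀ i, P[W i] = 0 := by
    intro i
    simp only [hWdef]
    rw [integral_finsetSum _ fun j _ => ((hL2 j).integrable (by norm_num)).const_mul _]
    simp_rw [integral_const_mul, h0]; simp
  have hWcov : ∀ i j, cov[W i, W j; P] = Matrix.diagonal d i j := by
    intro i j
    rw [← hd]
    simp only [hWdef]
    rw [covariance_fun_sum_fun_sum (fun k => (hL2 k).const_mul _) (fun k => (hL2 k).const_mul _)]
    simp only [covariance_const_mul_left, covariance_const_mul_right, Matrix.mul_apply,
      Matrix.transpose_apply, Finset.sum_mul]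
    rw [Finset.sum_comm]
    refine Finset.sum_congr rfl fun k _ => Finset.sum_congr rfl fun l _ => ?_
    simp only [hGdef, Matrix.of_apply]; ring
  have hvar : ∀ i, Var[W i; P] = d i := by
    intro i
    rw [← covariance_self (hWg.eval i).aemeasurable, hWcov]; simp
  have hsq : ∀ ω, ∑ i, W i ω ^ 2 = ∑ i, Z i ω ^ 2 := by
    intro ω
    have h1 : (fun i => W i ω) = Uᵀ *ᵥ (fun j => Z j ω) := by
      ext i; simp [hWdef, Matrix.mulVec, dotProduct]
    have h2 : (fun i => W i ω) ⬝ᵥ (fun i => W i ω) = (fun j => Z j ω) ⬝ᵥ (fun j => Z j ω) := by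
      rw [h1, Matrix.dotProduct_mulVec, Matrix.vecMul_transpose, Matrix.mulVec_mulVec, hU,
        Matrix.one_mulVec]
    simpa [dotProduct, sq] using h2
  have htr : ∑ i, d i = ∑ i, cov[Z i, Z i; P] := by
    have : (Matrix.diagonal d).trace = G.trace := by
      rw [← hd, Matrix.trace_mul_comm, ← mul_assoc, hU, one_mul]
    simpa [Matrix.trace, hGdef] using this
  -- the trace of `G * G` is both the sum of the squared eigenvalues and the squared Frobenius norm
  have htr2 : ∑ i, d i ^ 2 = ∑ i, ∑ j, cov[Z i, Z j; P] ^ 2 := by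
    have : (Matrix.diagonal d * Matrix.diagonal d).trace = (G * G).trace := by
      rw [← hd]
      calc (Uᵀ * G * U * (Uᵀ * G * U)).trace = (Uᵀ * (G * (U * Uᵀ) * G * U)).trace := by
            simp only [mul_assoc]
        _ = _ := by rw [hU, Matrix.trace_mul_comm, mul_one, mul_assoc, hU, mul_one]
    rw [Matrix.diagonal_mul_diagonal] at this
    simp only [Matrix.trace, Matrix.diag, Matrix.diagonal_apply_eq, Matrix.mul_apply] at this
    simp only [sq]
    rw [this]
    refine Finset.sum_congr rfl fun i _ => Finset.sum_congr rfl fun j _ => ?_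
    simp [hGdef, covariance_comm (Z j) (Z i)]
  have := measure_abs_sum_sq_sub_variance_ge_le (r := r) hWm hWg hW0
    (fun i j hij => by rw [hWcov]; simp [hij]) hVpos (by simpa [hvar, htr2] using hV)
  simpa only [Finset.sum_sub_distrib, hsq, hvar, htr] using this

end SumOfSquares

/-! ### Energy of the orbits of a stable matrix -/

section Energy

variable {H : Type*} [NormedAddCommGroup H] [InnerProductSpace ℂ H]

lemma sum_conj_pow_mul_pow {N : ℕ} {ζ : ℂ} (hζ : IsPrimitiveRoot ζ N) {k l : ℕ} (hk : k < N)
    (hl : l < N) :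
    ∑ j ∈ Finset.range N, (starRingEnd ℂ) (ζ ^ (j * k)) * ζ ^ (j * l)
      = if k = l then (N : ℂ) else 0 := by
  have hN : N ≠ 0 := by omega
  have hnorm : ‖ζ‖ = 1 := hζ.norm'_eq_one hN
  have hζ0 : ζ ≠ 0 := by rintro rfl; simp at hnorm
  have hinv : (starRingEnd ℂ) ζ = ζ⁻¹ := (Complex.inv_eq_conj hnorm).symm
  have hterm : ∀ j, (starRingEnd ℂ) (ζ ^ (j * k)) * ζ ^ (j * l) = ((ζ ^ k)⁻¹ * ζ ^ l) ^ j := by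
    intro j
    rw [map_pow, hinv, mul_pow, inv_pow, inv_pow, ← pow_mul, ← pow_mul, mul_comm k j, mul_comm l j]
  simp_rw [hterm]
  split_ifs with h
  · subst h
    simp [inv_mul_cancel₀ (pow_ne_zero k hζ0)]
  · have hr : (ζ ^ k)⁻¹ * ζ ^ l ≠ 1 := by
      intro h1
      have h2 : ζ ^ l = ζ ^ k := by
        have := congrArg (ζ ^ k * ·) h1
        simpa [mul_inv_cancel_left₀ (pow_ne_zero k hζ0)] using this
      exact h (hζ.pow_inj hk hl h2.symm)
    have hrN : ((ζ ^ k)⁻¹ * ζ ^ l) ^ N = 1 := by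
      rw [mul_pow, inv_pow, ← pow_mul, ← pow_mul, mul_comm k, mul_comm l, pow_mul, pow_mul,
        hζ.pow_eq_one]; simp
    rw [geom_sum_eq hr, hrN]; simp

/-- Parseval's identity for the finite Fourier transform of vectors of a Hilbert space. -/
lemma sum_norm_sq_sum_pow_smul {N : ℕ} {ζ : ℂ} (hζ : IsPrimitiveRoot ζ N) (x : ℕ → H) :
    ∑ j ∈ Finset.range N, ‖∑ k ∈ Finset.range N, ζ ^ (j * k) • x k‖ ^ 2
      = N * ∑ k ∈ Finset.range N, ‖x k‖ ^ 2 := by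
  have key : ∑ j ∈ Finset.range N, (inner ℂ (∑ k ∈ Finset.range N, ζ ^ (j * k) • x k)
      (∑ l ∈ Finset.range N, ζ ^ (j * l) • x l) : ℂ)
      = N * ∑ k ∈ Finset.range N, inner ℂ (x k) (x k) := by
    simp_rw [sum_inner, inner_sum, inner_smul_left, inner_smul_right]
    rw [Finset.sum_comm, Finset.mul_sum]
    refine Finset.sum_congr rfl fun k hk => ?_
    rw [Finset.sum_comm]
    have : ∀ l ∈ Finset.range N, ∑ j ∈ Finset.range N,
        (starRingEnd ℂ) (ζ ^ (j * k)) * (ζ ^ (j * l) * inner ℂ (x k) (x l))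
        = if k = l then N * inner ℂ (x k) (x l) else 0 := by
      intro l hl
      simp_rw [← mul_assoc]
      rw [← Finset.sum_mul,
        sum_conj_pow_mul_pow hζ (Finset.mem_range.1 hk) (Finset.mem_range.1 hl)]
      split_ifs <;> simp
    rw [Finset.sum_congr rfl this, Finset.sum_ite_eq]
    simp [hk]
  simp_rw [inner_self_eq_norm_sq_to_K] at key
  apply Complex.ofReal_injective
  push_cast
  exact key

/-- Telescoping of the geometric series of `z T`. -/
lemma smul_pow_sum_apply (T : H →L[ℂ] H) (z : ℂ) (N : ℕ) (w : H) :
    (∑ k ∈ Finset.range N, z ^ k • (T ^ k) w) - z • T (∑ k ∈ Finset.range N, z ^ k • (T ^ k) w)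
      = w - z ^ N • (T ^ N) w := by
  have := congrArg (fun B : H →L[ℂ] H => B w) (mul_neg_geom_sum (z • T) N)
  simpa only [smul_pow, mul_apply_eq_comp, sub_apply, one_apply_eq_self,
    smul_apply, sum_apply] using this

/-- The orbit of a vector under a stable operator has finite energy, controlled by the lower bound
of `1 - z T` on the unit circle: `1 - z T` maps the finite Fourier transform of the orbit at an
`N`-th root of unity `z` to `w - T ^ N w`, and Parseval's identity recovers the energy. -/
lemma sum_norm_sq_pow_le {T : H →L[ℂ] H} {m : ℝ} (hm : 0 < m)
    (hT : ∀ z : ℂ, ‖z‖ = 1 → ∀ v, m * ‖v‖ ^ 2 ≤ ‖v - z • T v‖ ^ 2)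
    (hlim : Tendsto (fun N => T ^ N) atTop (𝓝 0)) (w : H) (K : ℕ) :
    ∑ k ∈ Finset.range K, ‖(T ^ k) w‖ ^ 2 ≤ ‖w‖ ^ 2 / m := by
  have hlim' : Tendsto (fun N => ‖w - (T ^ N) w‖ ^ 2 / m) atTop (𝓝 (‖w - 0‖ ^ 2 / m)) := by
    have h1 : Tendsto (fun N => (T ^ N) w) atTop (𝓝 0) := by
      exact ((ContinuousLinearMap.apply ℂ H w).continuous.tendsto' 0 0 (map_zero _)).comp hlim
    exact ((tendsto_const_nhds.sub h1).norm.pow 2).div_const m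
  rw [sub_zero] at hlim'
  refine ge_of_tendsto hlim' ?_
  filter_upwards [eventually_ge_atTop K, eventually_gt_atTop 0] with N hNK hN
  have hζ := Complex.isPrimitiveRoot_exp N hN.ne'
  set ζ := Complex.exp (2 * Real.pi * Complex.I / N)
  have hN' : (0 : ℝ) < N := by exact_mod_cast hN
  have hmono : ∑ k ∈ Finset.range K, ‖(T ^ k) w‖ ^ 2 ≤ ∑ k ∈ Finset.range N, ‖(T ^ k) w‖ ^ 2 :=
    Finset.sum_le_sum_of_subset_of_nonneg (Finset.range_mono hNK) fun _ _ _ => sq_nonneg _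
  refine hmono.trans ?_
  rw [le_div_iff₀ hm]
  have hpars := sum_norm_sq_sum_pow_smul hζ fun k => (T ^ k) w
  have hj : ∀ j ∈ Finset.range N, m * ‖∑ k ∈ Finset.range N, ζ ^ (j * k) • (T ^ k) w‖ ^ 2
      ≤ ‖w - (T ^ N) w‖ ^ 2 := by
    intro j _
    have h1 := hT (ζ ^ j) (by rw [norm_pow, hζ.norm'_eq_one hN.ne', one_pow])
      (∑ k ∈ Finset.range N, (ζ ^ j) ^ k • (T ^ k) w)
    rw [smul_pow_sum_apply, ← pow_mul, mul_comm j N, pow_mul, hζ.pow_eq_one, one_pow,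
      one_smul] at h1
    simpa only [← pow_mul] using h1
  have hsum := Finset.sum_le_sum hj
  rw [← Finset.mul_sum, hpars, Finset.sum_const, Finset.card_range, nsmul_eq_mul] at hsum
  nlinarith

/-- A lower bound of `1 - z T` on the unit circle passes to the adjoint of `T`: in finite dimension
`1 - z T` is invertible, and the inverse has the same norm as its adjoint. -/
lemma adjoint_lower_bound [FiniteDimensional ℂ H] [CompleteSpace H] {T : H →L[ℂ] H} {m : ℝ}
    (hm : 0 < m)
    (hT : ∀ z : ℂ, ‖z‖ = 1 → ∀ v, m * ‖v‖ ^ 2 ≤ ‖v - z • T v‖ ^ 2) (z : ℂ)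
    (hz : ‖z‖ = 1) (v : H) :
    m * ‖v‖ ^ 2 ≤ ‖v - z • (ContinuousLinearMap.adjoint T) v‖ ^ 2 := by
  set B : H →L[ℂ] H := 1 - (starRingEnd ℂ z) • T with hB
  have hBv : ∀ v, m * ‖v‖ ^ 2 ≤ ‖B v‖ ^ 2 := fun v => by
    simpa [hB] using hT (starRingEnd ℂ z) (by simpa using hz) v
  have hinj : Function.Injective (B : H →ₗ[ℂ] H) := by
    rw [← LinearMap.ker_eq_bot, LinearMap.ker_eq_bot']
    intro x hx
    have h1 := hBv x
    rw [show B x = 0 from hx] at h1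
    have h2 : ‖x‖ ^ 2 = 0 := by
      have := sq_nonneg ‖x‖
      norm_num at h1; nlinarith
    simpa using h2
  obtain ⟨x, hx⟩ := (LinearMap.injective_iff_surjective.1 hinj) v
  have hx : B x = v := hx
  have hadj : v - z • (ContinuousLinearMap.adjoint T) v = ContinuousLinearMap.adjoint B v := by
    apply ext_inner_left ℂ
    intro y
    rw [ContinuousLinearMap.adjoint_inner_right, hB]
    simp [inner_sub_left, inner_sub_right, inner_smul_left, inner_smul_right,
      ContinuousLinearMap.adjoint_inner_right]
  rw [hadj]
  set a := ContinuousLinearMap.adjoint B v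
  have h1 : ‖v‖ ^ 2 ≤ ‖x‖ * ‖a‖ := by
    calc ‖v‖ ^ 2 = ‖(inner ℂ (B x) v : ℂ)‖ := by rw [hx, inner_self_eq_norm_sq_to_K]; simp
      _ = ‖(inner ℂ x a : ℂ)‖ := by rw [ContinuousLinearMap.adjoint_inner_right]
      _ ≤ _ := norm_inner_le_norm _ _
  have h2 := hBv x
  rw [hx] at h2
  rcases eq_or_ne v 0 with h0 | h0
  · rw [h0]; simp
  have hv : 0 < ‖v‖ := norm_pos_iff.2 h0
  have h3 : (‖v‖ ^ 2) ^ 2 ≤ (‖x‖ * ‖a‖) ^ 2 := by gcongr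
  have h4 : m * ‖v‖ ^ 2 * ‖v‖ ^ 2 ≤ ‖a‖ ^ 2 * ‖v‖ ^ 2 := by
    nlinarith [mul_le_mul_of_nonneg_right h2 (sq_nonneg ‖a‖), mul_le_mul_of_nonneg_left h3 hm.le]
  exact le_of_mul_le_mul_right h4 (by positivity)

end Energy

/-- Powers of an element with spectrum in the open unit disc tend to zero, by Gelfand's formula. -/
lemma tendsto_pow_zero_of_spectrum {B : Type*} [NormedRing B] [NormedAlgebra ℂ B] [CompleteSpace B]
    (a : B) (h : ∀ z ∈ spectrum ℂ a, ‖z‖ < 1) : Tendsto (fun N => a ^ N) atTop (𝓝 0) := by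
  cases subsingleton_or_nontrivial B with
  | inl hs => exact tendsto_const_nhds.congr fun N => Subsingleton.elim _ _
  | inr hn =>
  have hr : spectralRadius ℂ a < 1 := by
    have := spectrum.spectralRadius_lt_of_forall_lt (r := 1) a fun z hz => by
      exact_mod_cast h z hz
    exact_mod_cast this
  obtain ⟨r, hr1, hr2⟩ := ENNReal.lt_iff_exists_nnreal_btwn.1 hr
  have hr2' : r < 1 := by exact_mod_cast hr2
  have hg := spectrum.pow_nnnorm_pow_one_div_tendsto_nhds_spectralRadius a
  rw [tendsto_zero_iff_norm_tendsto_zero]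
  refine squeeze_zero' (Eventually.of_forall fun _ => norm_nonneg _) ?_
    (tendsto_pow_atTop_nhds_zero_of_lt_one r.coe_nonneg (by exact_mod_cast hr2'))
  filter_upwards [hg.eventually (gt_mem_nhds hr1), eventually_gt_atTop 0] with N hN hN0
  have h1 : (‖a ^ N‖₊ : ENNReal) ≤ (r : ENNReal) ^ N := by
    have h2 := ENNReal.rpow_le_rpow hN.le (show (0 : ℝ) ≤ N by positivity)
    rwa [← ENNReal.rpow_mul, one_div, inv_mul_cancel₀ (by exact_mod_cast hN0.ne'), ENNReal.rpow_one,
      ENNReal.rpow_natCast] at h2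
  exact_mod_cast h1

section Transition

variable {p : ℕ}

lemma complexify_pow_mulVec (A : Matrix (Fin p) (Fin p) ℝ) (k : ℕ) (w : Fin p → ℝ) :
    (complexify A ^ k) *ᵥ (fun i => (w i : ℂ)) = fun i => (((A ^ k) *ᵥ w) i : ℂ) := by
  have h : complexify A ^ k = (A ^ k).map (Complex.ofRealHom) :=
    (Matrix.map_pow A Complex.ofRealHom k).symm
  ext i
  rw [h]
  simp [Matrix.mulVec, dotProduct]

lemma norm_sq_ofReal_vec (w : Fin p → ℝ) :
    ‖(WithLp.toLp 2 (fun i => (w i : ℂ)) : EuclideanSpace ℂ (Fin p))‖ ^ 2 = w ⬝ᵥ w := by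
  rw [EuclideanSpace.norm_sq_eq]; simp [dotProduct, sq]

lemma char_lower_bound {κ₁ κ₂ m : ℝ} {A S : Matrix (Fin p) (Fin p) ℝ}
    (h : DependenceBounds κ₁ κ₂ m A S) (z : ℂ) (hz : ‖z‖ = 1) (v : EuclideanSpace ℂ (Fin p)) :
    m * ‖v‖ ^ 2 ≤ ‖v - z • Matrix.toEuclideanCLM (𝕜 := ℂ) (complexify A) v‖ ^ 2 := by
  have h1 := (h.char_lower z hz).dotProduct_mulVec_nonneg v.ofLp
  rw [Matrix.sub_mulVec, dotProduct_sub, ← Matrix.mulVec_mulVec, Matrix.dotProduct_mulVec,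
    Matrix.vecMul_conjTranspose, star_star, Matrix.smul_mulVec, Matrix.one_mulVec,
    dotProduct_smul] at h1
  have e1 : ∀ u : EuclideanSpace ℂ (Fin p), star u.ofLp ⬝ᵥ u.ofLp = ((‖u‖ ^ 2 : ℝ) : ℂ) := by
    intro u
    have := inner_self_eq_norm_sq_to_K (𝕜 := ℂ) u
    rw [EuclideanSpace.inner_eq_star_dotProduct, dotProduct_comm] at this
    rw [this]; simp
  have e2 : charPoly A z *ᵥ v.ofLp
      = (v - z • Matrix.toEuclideanCLM (𝕜 := ℂ) (complexify A) v).ofLp := by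
    simp [charPoly, Matrix.sub_mulVec, Matrix.smul_mulVec]
  rw [e2, e1, e1] at h1
  have h2 : (0 : ℂ) ≤
      ((‖v - z • Matrix.toEuclideanCLM (𝕜 := ℂ) (complexify A) v‖ ^ 2 - m * ‖v‖ ^ 2 : ℝ) : ℂ) := by
    simpa using h1
  have := Complex.zero_le_real.1 h2
  linarith

lemma tendsto_complexify_pow {A : Matrix (Fin p) (Fin p) ℝ} (h : IsStable A) :
    Tendsto (fun N => Matrix.toEuclideanCLM (𝕜 := ℂ) (complexify A) ^ N) atTop (𝓝 0) := by
  apply tendsto_pow_zero_of_spectrum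
  intro z hz
  apply h z
  rwa [AlgEquiv.spectrum_eq] at hz

lemma toEuclideanCLM_complexify_pow (A : Matrix (Fin p) (Fin p) ℝ) (k : ℕ) (w : Fin p → ℝ) :
    (Matrix.toEuclideanCLM (𝕜 := ℂ) (complexify A) ^ k) (WithLp.toLp 2 fun i => (w i : ℂ))
      = WithLp.toLp 2 (fun i => (((A ^ k) *ᵥ w) i : ℂ)) := by
  rw [← map_pow, ← complexify_pow_mulVec]; rfl

/-- Energy bound for the orbits of the transposed transition matrix. The projections of the
process on a direction `u` involve the orbit of `u` under `Aᵀ`. -/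
lemma sum_transpose_pow_mulVec_le {κ₁ κ₂ m : ℝ} (hm : 0 < m) {A S : Matrix (Fin p) (Fin p) ℝ}
    (hs : IsStable A) (h : DependenceBounds κ₁ κ₂ m A S) (w : Fin p → ℝ) (K : ℕ) :
    ∑ k ∈ Finset.range K, ((Aᵀ ^ k) *ᵥ w) ⬝ᵥ ((Aᵀ ^ k) *ᵥ w) ≤ (w ⬝ᵥ w) / m := by
  have hadj : Matrix.toEuclideanCLM (𝕜 := ℂ) (complexify Aᵀ)
      = ContinuousLinearMap.adjoint (Matrix.toEuclideanCLM (𝕜 := ℂ) (complexify A)) := by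
    rw [← ContinuousLinearMap.star_eq_adjoint, ← map_star]
    congr 1
    ext i j; simp [complexify, Matrix.star_apply]
  have hlim : Tendsto (fun N => Matrix.toEuclideanCLM (𝕜 := ℂ) (complexify Aᵀ) ^ N)
      atTop (𝓝 0) := by
    rw [hadj, ← ContinuousLinearMap.star_eq_adjoint]
    simp_rw [← star_pow]
    rw [tendsto_zero_iff_norm_tendsto_zero]
    simp_rw [ContinuousLinearMap.star_eq_adjoint, LinearIsometryEquiv.norm_map]
    exact tendsto_zero_iff_norm_tendsto_zero.1 (tendsto_complexify_pow hs)
  have hlow := adjoint_lower_bound hm (char_lower_bound h)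
  rw [← hadj] at hlow
  have := sum_norm_sq_pow_le hm hlow hlim (WithLp.toLp 2 fun i => (w i : ℂ)) K
  simpa only [toEuclideanCLM_complexify_pow, norm_sq_ofReal_vec] using this

lemma tendsto_pow_mulVec {A : Matrix (Fin p) (Fin p) ℝ} (hs : IsStable A) (w : Fin p → ℝ) :
    Tendsto (fun N => ((A ^ N) *ᵥ w) ⬝ᵥ ((A ^ N) *ᵥ w)) atTop (𝓝 0) := by
  have h1 : Tendsto (fun N => (Matrix.toEuclideanCLM (𝕜 := ℂ) (complexify A) ^ N)
      (WithLp.toLp 2 fun i => (w i : ℂ))) atTop (𝓝 0) := by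
    exact ((ContinuousLinearMap.apply ℂ (EuclideanSpace ℂ (Fin p))
      (WithLp.toLp 2 fun i => (w i : ℂ))).continuous.tendsto' 0 0 (map_zero _)).comp
        (tendsto_complexify_pow hs)
  have h2 := h1.norm.pow 2
  simp_rw [toEuclideanCLM_complexify_pow, norm_sq_ofReal_vec] at h2
  simpa using h2

end Transition

/-! ### Gaussian linear processes -/

section LinearProcess

variable {p : ℕ} {Ω : Type*} [MeasurableSpace Ω] {P : Measure Ω} {S : Matrix (Fin p) (Fin p) ℝ}

lemma dotProduct_ofLp_eq_inner (a : Fin p → ℝ) (x : EuclideanSpace ℝ (Fin p)) :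
    a ⬝ᵥ x.ofLp = inner ℝ (WithLp.toLp 2 a) x := by
  rw [EuclideanSpace.inner_eq_star_dotProduct, dotProduct_comm]; simp

section

variable {f : Ω → EuclideanSpace ℝ (Fin p)} (hf : Measurable f)
  (hlaw : P.map f = multivariateGaussian 0 S)

include hf hlaw

omit hf in
lemma hasGaussianLaw_of_law : HasGaussianLaw f P :=
  ⟨by rw [hlaw]; infer_instance⟩

lemma integral_dotProduct (a : Fin p → ℝ) : ∫ ω, a ⬝ᵥ (f ω).ofLp ∂P = 0 := by
  simp_rw [dotProduct_ofLp_eq_inner]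
  rw [← integral_map (f := fun x => (inner ℝ (WithLp.toLp 2 a) x : ℝ)) hf.aemeasurable
    (by fun_prop), hlaw]
  refine (integral_inner (f := id) IsGaussian.integrable_id _).trans ?_
  rw [integral_id_multivariateGaussian']
  simp

lemma covariance_dotProduct (hS : S.PosSemidef) (a b : Fin p → ℝ) :
    cov[fun ω => a ⬝ᵥ (f ω).ofLp, fun ω => b ⬝ᵥ (f ω).ofLp; P] = a ⬝ᵥ S *ᵥ b := by
  simp_rw [dotProduct_ofLp_eq_inner]
  have h := covarianceBilin_multivariateGaussian (μ := 0) hS (WithLp.toLp 2 a) (WithLp.toLp 2 b)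
  rw [covarianceBilin_apply_eq_cov IsGaussian.memLp_two_id, ← hlaw,
    covariance_map (by fun_prop) (by fun_prop) hf.aemeasurable] at h
  exact h

end

variable [IsProbabilityMeasure P] {κ ι : Type*} [Fintype κ] [Fintype ι]
  {e : κ → Ω → EuclideanSpace ℝ (Fin p)} (hm : ∀ j, Measurable (e j)) (hind : iIndepFun e P)
  (hlaw : ∀ j, P.map (e j) = multivariateGaussian 0 S) (a : ι → κ → Fin p → ℝ)

include hm hind hlaw

omit [IsProbabilityMeasure P] hm in
lemma hasGaussianLaw_linear :
    HasGaussianLaw (fun ω i => ∑ j, a i j ⬝ᵥ (e j ω).ofLp) P := by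
  have h := hind.hasGaussianLaw fun j => hasGaussianLaw_of_law (hlaw j)
  have h2 := h.map_fun (ContinuousLinearMap.pi fun i =>
    ∑ j, (innerSL ℝ (WithLp.toLp 2 (a i j))) ∘L
      (ContinuousLinearMap.proj (R := ℝ) (φ := fun _ : κ => EuclideanSpace ℝ (Fin p)) j))
  refine h2.congr (ae_of_all _ fun ω => ?_)
  ext i
  simp [dotProduct_ofLp_eq_inner, sum_apply]

omit [IsProbabilityMeasure P] [Fintype ι] hind in
lemma integral_linear (i : ι) : ∫ ω, ∑ j, a i j ⬝ᵥ (e j ω).ofLp ∂P = 0 := by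
  rw [integral_finsetSum]
  · exact Finset.sum_eq_zero fun j _ => integral_dotProduct (hm j) (hlaw j) _
  · intro j _
    simp_rw [dotProduct_ofLp_eq_inner]
    exact (hasGaussianLaw_of_law (hlaw j)).integrable.const_inner _

omit [Fintype ι] in
lemma covariance_linear (hS : S.PosSemidef) (i i' : ι) :
    cov[fun ω => ∑ j, a i j ⬝ᵥ (e j ω).ofLp, fun ω => ∑ j, a i' j ⬝ᵥ (e j ω).ofLp; P]
      = ∑ j, a i j ⬝ᵥ S *ᵥ a i' j := by
  classical
  have hL2 : ∀ i j, MemLp (fun ω => a i j ⬝ᵥ (e j ω).ofLp) 2 P := by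
    intro i j
    simp_rw [dotProduct_ofLp_eq_inner]
    exact (hasGaussianLaw_of_law (hlaw j)).memLp_two.const_inner _
  rw [covariance_fun_sum_fun_sum (hL2 i) (hL2 i')]
  refine Finset.sum_congr rfl fun j _ => ?_
  rw [Finset.sum_eq_single j, covariance_dotProduct (hm j) (hlaw j) hS]
  · intro k _ hk
    have h1 := (hind.indepFun hk.symm).comp
      (φ := fun x => a i j ⬝ᵥ x.ofLp) (ψ := fun x => a i' k ⬝ᵥ x.ofLp)
      (by simp_rw [dotProduct_ofLp_eq_inner]; fun_prop)
      (by simp_rw [dotProduct_ofLp_eq_inner]; fun_prop)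
    exact h1.covariance_eq_zero (hL2 i j) (hL2 i' k)
  · simp

end LinearProcess

section Covariance

variable {p : ℕ} {A S : Matrix (Fin p) (Fin p) ℝ}

/-- The covariance matrix `∑ i ≤ k, A ^ i S (Aᵀ) ^ i` of a sum `∑ i ≤ k, A ^ i e (-i)` of `k + 1`
propagated innovations. -/
def truncCov (A S : Matrix (Fin p) (Fin p) ℝ) (k : ℕ) : Matrix (Fin p) (Fin p) ℝ :=
  ∑ i ∈ Finset.range (k + 1), A ^ i * S * Aᵀ ^ i

lemma dotProduct_pow_mulVec (i : ℕ) (a b : Fin p → ℝ) :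
    a ⬝ᵥ (A ^ i *ᵥ b) = (Aᵀ ^ i *ᵥ a) ⬝ᵥ b := by
  rw [Matrix.dotProduct_mulVec, ← Matrix.transpose_pow, Matrix.mulVec_transpose]

lemma dotProduct_truncCov_mulVec (k : ℕ) (a b : Fin p → ℝ) :
    a ⬝ᵥ truncCov A S k *ᵥ b
      = ∑ i ∈ Finset.range (k + 1), (Aᵀ ^ i *ᵥ a) ⬝ᵥ S *ᵥ (Aᵀ ^ i *ᵥ b) := by
  rw [truncCov, Matrix.sum_mulVec, dotProduct_sum]
  refine Finset.sum_congr rfl fun i _ => ?_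
  rw [← Matrix.mulVec_mulVec, ← Matrix.mulVec_mulVec, dotProduct_pow_mulVec]

lemma posSemidef_truncCov (hS : S.PosSemidef) (k : ℕ) : (truncCov A S k).PosSemidef := by
  refine Matrix.posSemidef_sum _ fun i _ => ?_
  have := hS.mul_mul_conjTranspose_same (A ^ i)
  simpa [Matrix.transpose_pow] using this

/-- The Cauchy–Schwarz inequality for a positive semidefinite form. -/
lemma sq_dotProduct_mulVec_le {M : Matrix (Fin p) (Fin p) ℝ} (hM : M.PosSemidef) (a b : Fin p → ℝ) :
    (a ⬝ᵥ M *ᵥ b) ^ 2 ≤ (a ⬝ᵥ M *ᵥ a) * (b ⬝ᵥ M *ᵥ b) := by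
  have h0 : ∀ x, 0 ≤ (Matrix.toBilin' M) x x := fun x => by
    rw [Matrix.toBilin'_apply']; simpa using hM.dotProduct_mulVec_nonneg x
  have h := LinearMap.BilinForm.apply_mul_apply_le_of_forall_zero_le (Matrix.toBilin' M) h0 a b
  simp only [Matrix.toBilin'_apply'] at h
  have hT : Mᵀ = M := by simpa using hM.isHermitian.eq
  have hsymm : b ⬝ᵥ M *ᵥ a = a ⬝ᵥ M *ᵥ b := by
    conv_lhs => rw [Matrix.dotProduct_mulVec, ← hT, Matrix.vecMul_transpose, dotProduct_comm]
  rwa [hsymm, ← sq] at h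

lemma dotProduct_noise_le {κ₁ κ₂ m : ℝ} (h : DependenceBounds κ₁ κ₂ m A S) (a : Fin p → ℝ) :
    a ⬝ᵥ S *ᵥ a ≤ κ₂ * (a ⬝ᵥ a) := by
  have := h.noise_upper.dotProduct_mulVec_nonneg a
  simp [Matrix.sub_mulVec, Matrix.smul_mulVec] at this
  linarith

lemma le_dotProduct_noise {κ₁ κ₂ m : ℝ} (h : DependenceBounds κ₁ κ₂ m A S) (a : Fin p → ℝ) :
    κ₁ * (a ⬝ᵥ a) ≤ a ⬝ᵥ S *ᵥ a := by
  have := h.noise_lower.dotProduct_mulVec_nonneg a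
  simp [Matrix.sub_mulVec, Matrix.smul_mulVec] at this
  linarith

lemma posSemidef_noise {κ₁ κ₂ m : ℝ} (hκ₁ : 0 < κ₁) (h : DependenceBounds κ₁ κ₂ m A S) :
    S.PosSemidef := by
  have := h.noise_lower.add (Matrix.PosSemidef.one.smul hκ₁.le)
  simpa using this

lemma le_dotProduct_truncCov {κ₁ κ₂ m : ℝ} (hκ₁ : 0 < κ₁) (h : DependenceBounds κ₁ κ₂ m A S)
    (k : ℕ) (a : Fin p → ℝ) : κ₁ * (a ⬝ᵥ a) ≤ a ⬝ᵥ truncCov A S k *ᵥ a := by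
  rw [dotProduct_truncCov_mulVec, Finset.sum_range_succ']
  have h1 : 0 ≤ ∑ i ∈ Finset.range k, (Aᵀ ^ (i + 1) *ᵥ a) ⬝ᵥ S *ᵥ (Aᵀ ^ (i + 1) *ᵥ a) :=
    Finset.sum_nonneg fun i _ => by
      simpa using (posSemidef_noise hκ₁ h).dotProduct_mulVec_nonneg (Aᵀ ^ (i + 1) *ᵥ a)
  have h2 := le_dotProduct_noise h a
  simp only [pow_zero, Matrix.one_mulVec]
  linarith

lemma dotProduct_truncCov_le {κ₁ κ₂ m : ℝ} (hκ₂ : 0 < κ₂) (hm : 0 < m) (hs : IsStable A)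
    (h : DependenceBounds κ₁ κ₂ m A S) (k : ℕ) (a : Fin p → ℝ) :
    a ⬝ᵥ truncCov A S k *ᵥ a ≤ κ₂ / m * (a ⬝ᵥ a) := by
  rw [dotProduct_truncCov_mulVec]
  calc _ ≤ ∑ i ∈ Finset.range (k + 1), κ₂ * ((Aᵀ ^ i *ᵥ a) ⬝ᵥ (Aᵀ ^ i *ᵥ a)) :=
        Finset.sum_le_sum fun i _ => dotProduct_noise_le h _
    _ = κ₂ * ∑ i ∈ Finset.range (k + 1), (Aᵀ ^ i *ᵥ a) ⬝ᵥ (Aᵀ ^ i *ᵥ a) := by rw [Finset.mul_sum]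
    _ ≤ κ₂ * ((a ⬝ᵥ a) / m) :=
        mul_le_mul_of_nonneg_left (sum_transpose_pow_mulVec_le hm hs h a _) hκ₂.le
    _ = _ := by ring

/-- The coefficient, in direction `u`, of the innovation at time `j` in the state at time `k`. -/
def propagator (A : Matrix (Fin p) (Fin p) ℝ) (u : Fin p → ℝ) (k j : ℕ) : Fin p → ℝ :=
  if j ≤ k then Aᵀ ^ (k - j) *ᵥ u else 0

/-- The covariance at times `l ≤ k` of the projections of the truncated process on `u`. -/
lemma sum_propagator (u : Fin p → ℝ) {M k l : ℕ} (hlk : l ≤ k) (hk : k < M) :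
    ∑ j : Fin M, propagator A u k j ⬝ᵥ S *ᵥ propagator A u l j
      = (Aᵀ ^ (k - l) *ᵥ u) ⬝ᵥ truncCov A S l *ᵥ u := by
  rw [Fin.sum_univ_eq_sum_range
    (fun j => propagator A u k j ⬝ᵥ S *ᵥ propagator A u l j), dotProduct_truncCov_mulVec]
  symm
  rw [← Finset.sum_range_reflect]
  have hsub : Finset.range (l + 1) ⊆ Finset.range M := Finset.range_mono (by omega)
  refine Eq.trans (Finset.sum_congr rfl fun j hj => ?_) (Finset.sum_subset hsub fun j _ hj => ?_)
  · have hj' : j ≤ l := by simpa [Nat.lt_succ_iff] using hj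
    rw [propagator, propagator, if_pos (hj'.trans hlk), if_pos hj', Matrix.mulVec_mulVec, ← pow_add,
      show l + 1 - 1 - j = l - j by omega, show l - j + (k - l) = k - j by omega]
  · have hj' : ¬ j ≤ l := by simpa [Nat.lt_succ_iff] using hj
    simp [propagator, hj']

/-- The squared Frobenius norm of an `n × n` matrix grows at most linearly in `n`, if its squared
entries are bounded by a summable function of the distance to the diagonal. -/
lemma sum_sum_sq_le {n : ℕ} {G : Fin n → Fin n → ℝ} {q : ℕ → ℝ} {B : ℝ} (hq : ∀ h, 0 ≤ q h)
    (hB : ∀ K, ∑ h ∈ Finset.range K, q h ≤ B) (hsymm : ∀ s t, G s t = G t s)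
    (hG : ∀ s t : Fin n, s ≤ t → G t s ^ 2 ≤ q (t - s)) :
    ∑ t, ∑ s, G t s ^ 2 ≤ 2 * n * B := by
  set f : Fin n → Fin n → ℝ := fun t s => if s ≤ t then q (t - s) else 0 with hf
  have hf0 : ∀ t s, 0 ≤ f t s := fun t s => by
    simp only [hf]; split_ifs; exacts [hq _, le_rfl]
  have h1 : ∀ t s, G t s ^ 2 ≤ f t s + f s t := by
    intro t s
    rcases le_total s t with h | h
    · have : f t s = q (t - s) := if_pos h
      linarith [hG s t h, hf0 s t]
    · have : f s t = q (s - t) := if_pos h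
      rw [hsymm]
      linarith [hG t s h, hf0 t s]
  have h2 : ∀ t : Fin n, ∑ s, f t s ≤ B := by
    intro t
    refine le_trans (le_of_eq ?_) (hB (t + 1))
    rw [← Finset.sum_range_reflect]
    have hsub : Finset.range ((t : ℕ) + 1) ⊆ Finset.range n := Finset.range_mono (by omega)
    have e1 : ∑ s, f t s = ∑ s ∈ Finset.range n, if s ≤ (t : ℕ) then q (t - s) else 0 := by
      rw [← Fin.sum_univ_eq_sum_range (fun s => if s ≤ (t : ℕ) then q (t - s) else 0)]
      simp [hf]
    rw [e1]
    symm
    refine Eq.trans (Finset.sum_congr rfl fun j hj => ?_) (Finset.sum_subset hsub fun j _ hj => ?_)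
    · have hj' : j ≤ t := by simpa [Nat.lt_succ_iff] using hj
      rw [if_pos hj']; congr 1
    · have hj' : ¬ j ≤ t := by simpa [Nat.lt_succ_iff] using hj
      rw [if_neg hj']
  calc ∑ t, ∑ s, G t s ^ 2 ≤ ∑ t, ∑ s, (f t s + f s t) :=
        Finset.sum_le_sum fun t _ => Finset.sum_le_sum fun s _ => h1 t s
    _ = ∑ t, ∑ s, f t s + ∑ t, ∑ s, f t s := by
        simp_rw [Finset.sum_add_distrib]
        congr 1
        exact Finset.sum_comm
    _ ≤ ∑ _t : Fin n, B + ∑ _t : Fin n, B :=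
        add_le_add (Finset.sum_le_sum fun t _ => h2 t) (Finset.sum_le_sum fun t _ => h2 t)
    _ = 2 * n * B := by simp; ring

end Covariance

section Innovations

variable {p : ℕ} {Ω : Type*} [MeasurableSpace Ω] {P : Measure Ω} {A S : Matrix (Fin p) (Fin p) ℝ}
  {y e : ℤ → Ω → EuclideanSpace ℝ (Fin p)}

/-- The contribution to the state at time `k - N` of the innovations at the times `-N, …, k - N`. -/
def innovationSum (A : Matrix (Fin p) (Fin p) ℝ) (e : ℤ → Ω → EuclideanSpace ℝ (Fin p)) (N k : ℕ)
    (ω : Ω) : Fin p → ℝ :=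
  ∑ j ∈ Finset.range (k + 1), A ^ (k - j) *ᵥ (e ((j : ℤ) - N) ω).ofLp

omit [MeasurableSpace Ω] in
lemma innovationSum_succ (N k : ℕ) (ω : Ω) :
    innovationSum A e N (k + 1) ω
      = A *ᵥ innovationSum A e N k ω + (e ((k + 1 : ℕ) - N : ℤ) ω).ofLp := by
  rw [innovationSum, Finset.sum_range_succ, innovationSum, Matrix.mulVec_sum]
  congr 1
  · refine Finset.sum_congr rfl fun j hj => ?_
    have hj' : j ≤ k := by simpa [Nat.lt_succ_iff] using hj
    rw [Matrix.mulVec_mulVec, ← pow_succ', Nat.succ_sub hj']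
  · simp

omit [MeasurableSpace Ω] in
lemma dotProduct_innovationSum (u : Fin p → ℝ) {M k : ℕ} (N : ℕ) (hk : k < M) (ω : Ω) :
    u ⬝ᵥ innovationSum A e N k ω
      = ∑ j : Fin M, propagator A u k j ⬝ᵥ (e ((j : ℕ) - N : ℤ) ω).ofLp := by
  rw [Fin.sum_univ_eq_sum_range
    (fun j => propagator A u k j ⬝ᵥ (e ((j : ℕ) - N : ℤ) ω).ofLp), innovationSum, dotProduct_sum]
  have hsub : Finset.range (k + 1) ⊆ Finset.range M := Finset.range_mono (by omega)
  refine Eq.trans (Finset.sum_congr rfl fun j hj => ?_) (Finset.sum_subset hsub fun j _ hj => ?_)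
  · have hj' : j ≤ k := by simpa [Nat.lt_succ_iff] using hj
    rw [propagator, if_pos hj', dotProduct_pow_mulVec]
  · have hj' : ¬ j ≤ k := by simpa [Nat.lt_succ_iff] using hj
    simp [propagator, hj']

/-- The recursion, iterated down to time `-N - 1`. -/
lemma process_eq_innovationSum_add (h : IsStableGaussianVAR P A S y e) (N k : ℕ) :
    ∀ᵐ ω ∂P, (y ((k : ℤ) - N) ω).ofLp
      = innovationSum A e N k ω + A ^ (k + 1) *ᵥ (y (-N - 1 : ℤ) ω).ofLp := by
  induction k with
  | zero =>
    filter_upwards [h.recursion (-N)] with ω hω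
    simp [innovationSum, hω, add_comm]
  | succ k ih =>
    filter_upwards [ih, h.recursion ((k + 1 : ℕ) - N : ℤ)] with ω h1 h2
    rw [h2, innovationSum_succ, show ((k + 1 : ℕ) - N - 1 : ℤ) = k - N by push_cast; ring, h1]
    simp only [WithLp.ofLp_add, Matrix.mulVec_add, Matrix.mulVec_mulVec, ← pow_succ']
    abel

variable [IsProbabilityMeasure P]

/-- Concentration of the empirical second moment of the truncated process in a fixed direction. -/
lemma measure_abs_sum_sq_innovationSum_ge_le {κ₁ κ₂ m : ℝ} (hκ₁ : 0 < κ₁) (hκ₂ : 0 < κ₂)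
    (hm : 0 < m) (hd : DependenceBounds κ₁ κ₂ m A S) (h : IsStableGaussianVAR P A S y e) (N n : ℕ)
    (u : Fin p → ℝ) {V r : ℝ} (hV0 : 0 < V)
    (hV : 2 * n * ((κ₂ / m) ^ 2 * (u ⬝ᵥ u) ^ 2 / m) ≤ V) :
    P.real {ω | r ≤ |∑ t : Fin n, (u ⬝ᵥ innovationSum A e N (t + N) ω) ^ 2
        - ∑ t : Fin n, u ⬝ᵥ truncCov A S (t + N) *ᵥ u|} ≤ 4 * Real.exp (-r / (4 * √V)) := by
  have hS := posSemidef_noise hκ₁ hd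
  set e' : Fin (n + N) → Ω → EuclideanSpace ℝ (Fin p) := fun j => e ((j : ℕ) - N : ℤ) with he'
  have hm' : ∀ j, Measurable (e' j) := fun j => h.measurable_noise _
  have hind : iIndepFun e' P := h.noise_indep.precomp
    (g := fun j : Fin (n + N) => ((j : ℕ) - N : ℤ))
    fun i j hij => by simpa [Fin.ext_iff] using hij
  have hlaw : ∀ j, P.map (e' j) = multivariateGaussian 0 S := fun j => h.noise_law _
  set a : Fin n → Fin (n + N) → Fin p → ℝ := fun t j => propagator A u (t + N) j with ha
  have hx : ∀ (t : Fin n) ω, u ⬝ᵥ innovationSum A e N (t + N) ω = ∑ j, a t j ⬝ᵥ (e' j ω).ofLp :=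
    fun t ω => dotProduct_innovationSum u N (by omega) ω
  have hcov := covariance_linear hm' hind hlaw a hS
  have hcov' : ∀ s t : Fin n, s ≤ t →
      cov[fun ω => ∑ j, a t j ⬝ᵥ (e' j ω).ofLp, fun ω => ∑ j, a s j ⬝ᵥ (e' j ω).ofLp; P]
        = (Aᵀ ^ ((t : ℕ) - s) *ᵥ u) ⬝ᵥ truncCov A S (s + N) *ᵥ u := by
    intro s t hst
    have hst' : (s : ℕ) ≤ t := hst
    rw [hcov, sum_propagator u (by omega) (by omega),
      show (t : ℕ) + N - (s + N) = t - s by omega]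
  have hfrob : ∑ t, ∑ s, cov[fun ω => ∑ j, a t j ⬝ᵥ (e' j ω).ofLp,
      fun ω => ∑ j, a s j ⬝ᵥ (e' j ω).ofLp; P] ^ 2 ≤ V := by
    refine (sum_sum_sq_le (q := fun k => (κ₂ / m) ^ 2 * (u ⬝ᵥ u) *
      ((Aᵀ ^ k *ᵥ u) ⬝ᵥ (Aᵀ ^ k *ᵥ u))) (B := (κ₂ / m) ^ 2 * (u ⬝ᵥ u) ^ 2 / m) ?_ ?_ ?_ ?_).trans hV
    · intro k
      have h1 : 0 ≤ u ⬝ᵥ u := by simpa using dotProduct_star_self_nonneg u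
      have h2 : 0 ≤ (Aᵀ ^ k *ᵥ u) ⬝ᵥ (Aᵀ ^ k *ᵥ u) := by
        simpa using dotProduct_star_self_nonneg (Aᵀ ^ k *ᵥ u)
      positivity
    · intro K
      have h1 : 0 ≤ u ⬝ᵥ u := by simpa using dotProduct_star_self_nonneg u
      rw [← Finset.mul_sum]
      calc _ ≤ (κ₂ / m) ^ 2 * (u ⬝ᵥ u) * ((u ⬝ᵥ u) / m) :=
            mul_le_mul_of_nonneg_left (sum_transpose_pow_mulVec_le hm h.stable hd u K)
              (by positivity)
        _ = _ := by ring
    · intro s t; exact covariance_comm _ _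
    · intro s t hst
      rw [hcov' s t hst]
      refine (sq_dotProduct_mulVec_le (posSemidef_truncCov hS _) _ _).trans ?_
      have h1 : 0 ≤ u ⬝ᵥ u := by simpa using dotProduct_star_self_nonneg u
      set w := Aᵀ ^ ((t : ℕ) - s) *ᵥ u
      have h2 : 0 ≤ w ⬝ᵥ w := by simpa using dotProduct_star_self_nonneg w
      have h3 := dotProduct_truncCov_le hκ₂ hm h.stable hd (s + N) w
      have h4 := dotProduct_truncCov_le hκ₂ hm h.stable hd (s + N) u
      have h5 : 0 ≤ u ⬝ᵥ truncCov A S (s + N) *ᵥ u := by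
        simpa using (posSemidef_truncCov hS _).dotProduct_mulVec_nonneg u
      calc _ ≤ (κ₂ / m * (w ⬝ᵥ w)) * (κ₂ / m * (u ⬝ᵥ u)) := mul_le_mul h3 h4 h5 (by positivity)
        _ = _ := by ring
  have hmeas : ∀ t : Fin n, Measurable fun ω => ∑ j, a t j ⬝ᵥ (e' j ω).ofLp := by
    intro t
    simp_rw [dotProduct_ofLp_eq_inner]
    fun_prop
  have key := measure_abs_sum_sq_sub_ge_le (r := r) hmeas
    (hasGaussianLaw_linear hind hlaw a) (fun t => integral_linear hm' hlaw a t) hV0 hfrob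
  have hdiag : ∀ t : Fin n, cov[fun ω => ∑ j, a t j ⬝ᵥ (e' j ω).ofLp,
      fun ω => ∑ j, a t j ⬝ᵥ (e' j ω).ofLp; P] = u ⬝ᵥ truncCov A S (t + N) *ᵥ u := by
    intro t; rw [hcov' t t le_rfl]; simp
  simp_rw [hdiag] at key
  simp_rw [hx]
  exact key

end Innovations

/-! ### Deviation in sparse directions -/

section Deterministic

variable {p : ℕ}

/-- The vector `e_j + e_k` or `e_j - e_k`, according to the sign `b`. -/
def signedPair (j k : Fin p) (b : Bool) : Fin p → ℝ :=
  Pi.single j 1 + (if b then (1 : ℝ) else -1) • Pi.single k 1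

lemma signedPair_dotProduct_self_le (j k : Fin p) (b : Bool) :
    signedPair j k b ⬝ᵥ signedPair j k b ≤ 4 := by
  have h : ∀ i j : Fin p, (Pi.single i (1 : ℝ) : Fin p → ℝ) j ≤ 1 := by
    intro i j; rw [Pi.single_apply]; split_ifs <;> norm_num
  have h0 : ∀ i j : Fin p, 0 ≤ (Pi.single i (1 : ℝ) : Fin p → ℝ) j := by
    intro i j; rw [Pi.single_apply]; split_ifs <;> norm_num
  have h1 := h j k
  have h2 := h k j
  have h3 := h0 j k
  have h4 := h0 k j
  cases b <;> simp [signedPair, dotProduct_add] <;> linarith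

/-- Polarization: a symmetric quadratic form that is small at the vectors `e_j ± e_k` has small
entries. -/
lemma abs_apply_le_of_signedPair {M : Matrix (Fin p) (Fin p) ℝ} (hM : M.IsSymm) {δ : ℝ}
    (h : ∀ j k b, |signedPair j k b ⬝ᵥ M *ᵥ signedPair j k b| ≤ 2 * δ) (j k : Fin p) :
    |M j k| ≤ δ := by
  have h1 := h j k true
  have h2 := h j k false
  have hs : M k j = M j k := hM.apply j k
  have e1 : signedPair j k true ⬝ᵥ M *ᵥ signedPair j k true = M j j + M k k + 2 * M j k := by
    simp [signedPair, Matrix.mulVec_add, add_dotProduct, dotProduct_add, hs]; ring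
  have e2 : signedPair j k false ⬝ᵥ M *ᵥ signedPair j k false = M j j + M k k - 2 * M j k := by
    simp [signedPair, Matrix.mulVec_add, Matrix.mulVec_neg, add_dotProduct, dotProduct_add, hs]
    ring
  rw [e1] at h1
  rw [e2] at h2
  rw [abs_le] at h1 h2 ⊢
  constructor <;> linarith [h1.1, h1.2, h2.1, h2.2]

/-- A quadratic form with small entries is small at sparse vectors, as `‖v‖₁ ^ 2 ≤ ‖v‖₀ ‖v‖ ^ 2`. -/
lemma abs_dotProduct_mulVec_le {M : Matrix (Fin p) (Fin p) ℝ} {δ : ℝ} (hδ : 0 ≤ δ)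
    (h : ∀ j k, |M j k| ≤ δ) (v : Fin p → ℝ) :
    |v ⬝ᵥ M *ᵥ v| ≤ δ * (l0 v * (v ⬝ᵥ v)) := by
  have h1 : |v ⬝ᵥ M *ᵥ v| ≤ δ * (∑ j, |v j|) ^ 2 := by
    calc |v ⬝ᵥ M *ᵥ v| = |∑ j, ∑ k, v j * (M j k * v k)| := by
          simp [dotProduct, Matrix.mulVec, Finset.mul_sum]
      _ ≤ ∑ j, ∑ k, |v j * (M j k * v k)| :=
          (Finset.abs_sum_le_sum_abs _ _).trans
            (Finset.sum_le_sum fun j _ => Finset.abs_sum_le_sum_abs _ _)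
      _ ≤ ∑ j, ∑ k, δ * (|v j| * |v k|) := by
          refine Finset.sum_le_sum fun j _ => Finset.sum_le_sum fun k _ => ?_
          rw [abs_mul, abs_mul]
          nlinarith [mul_le_mul_of_nonneg_right (h j k)
            (mul_nonneg (abs_nonneg (v j)) (abs_nonneg (v k)))]
      _ = δ * (∑ j, |v j|) ^ 2 := by
          rw [sq, Finset.sum_mul_sum, Finset.mul_sum]
          simp_rw [Finset.mul_sum]
  refine h1.trans (mul_le_mul_of_nonneg_left ?_ hδ)
  have h2 : ∑ j, |v j| = ∑ j ∈ Finset.univ.filter fun j => v j ≠ 0, |v j| := by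
    symm
    refine Finset.sum_subset (Finset.subset_univ _) fun j _ hj => ?_
    simpa using hj
  rw [h2]
  refine sq_sum_le_card_mul_sum_sq.trans ?_
  refine mul_le_mul_of_nonneg_left ?_ (Nat.cast_nonneg _)
  calc _ ≤ ∑ j, |v j| ^ 2 :=
        Finset.sum_le_sum_of_subset_of_nonneg (Finset.subset_univ _) fun _ _ _ => sq_nonneg _
    _ = v ⬝ᵥ v := by simp [dotProduct, sq]

/-- If the empirical second moments of the vectors `x t`, in all directions `e_j ± e_k`, are close
to their expectations, then they are close to them in all sparse directions. -/
lemma abs_sum_sq_sub_le {n : ℕ} {x : Fin n → Fin p → ℝ} {Γ : Fin n → Matrix (Fin p) (Fin p) ℝ}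
    (hΓ : ∀ t, (Γ t).IsSymm) {δ : ℝ} (hδ : 0 ≤ δ)
    (h : ∀ j k b, |∑ t, (signedPair j k b ⬝ᵥ x t) ^ 2
      - ∑ t, signedPair j k b ⬝ᵥ Γ t *ᵥ signedPair j k b| ≤ 2 * δ) (v : Fin p → ℝ) :
    |∑ t, (v ⬝ᵥ x t) ^ 2 - ∑ t, v ⬝ᵥ Γ t *ᵥ v| ≤ δ * (l0 v * (v ⬝ᵥ v)) := by
  set M : Matrix (Fin p) (Fin p) ℝ := ∑ t, (Matrix.vecMulVec (x t) (x t) - Γ t) with hM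
  have hsymm : M.IsSymm := by
    rw [Matrix.IsSymm, hM, Matrix.transpose_sum]
    refine Finset.sum_congr rfl fun t _ => ?_
    rw [Matrix.transpose_sub, Matrix.transpose_vecMulVec, (hΓ t).eq]
  have hq : ∀ u : Fin p → ℝ, u ⬝ᵥ M *ᵥ u = ∑ t, (u ⬝ᵥ x t) ^ 2 - ∑ t, u ⬝ᵥ Γ t *ᵥ u := by
    intro u
    rw [hM, Matrix.sum_mulVec, dotProduct_sum, ← Finset.sum_sub_distrib]
    refine Finset.sum_congr rfl fun t _ => ?_
    rw [Matrix.sub_mulVec, dotProduct_sub, Matrix.vecMulVec_mulVec]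
    simp [dotProduct_comm (x t) u, sq]
  rw [← hq]
  exact abs_dotProduct_mulVec_le hδ
    (abs_apply_le_of_signedPair hsymm fun j k b => by rw [hq]; exact h j k b) v

lemma abs_sum_sq_sub_sum_sq_le {n : ℕ} {a b : Fin n → ℝ} {ε : ℝ} (hε : 0 ≤ ε) (hε1 : ε ≤ 1)
    (h : ∀ t, |a t - b t| ≤ ε) :
    |∑ t, a t ^ 2 - ∑ t, b t ^ 2| ≤ ε * (∑ t, b t ^ 2 + 2 * n) := by
  rw [← Finset.sum_sub_distrib]
  refine (Finset.abs_sum_le_sum_abs _ _).trans ?_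
  have : ∀ t, |a t ^ 2 - b t ^ 2| ≤ ε * (b t ^ 2 + 2) := by
    intro t
    obtain ⟨h1, h2⟩ := abs_le.1 (h t)
    have h3 : a t ^ 2 - b t ^ 2 = 2 * b t * (a t - b t) + (a t - b t) ^ 2 := by ring
    have h4 : (a t - b t) ^ 2 ≤ ε := by
      calc (a t - b t) ^ 2 ≤ ε ^ 2 := sq_le_sq' h1 h2
        _ ≤ ε := by nlinarith
    have h5 : |2 * b t * (a t - b t)| ≤ (b t ^ 2 + 1) * ε := by
      rw [abs_mul]
      refine mul_le_mul ?_ (h t) (abs_nonneg _) (by positivity)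
      rw [abs_le]; constructor <;> nlinarith [sq_nonneg (b t + 1), sq_nonneg (b t - 1)]
    rw [h3]
    refine (abs_add_le _ _).trans ?_
    rw [abs_of_nonneg (sq_nonneg (a t - b t))]
    linarith
  refine (Finset.sum_le_sum fun t _ => this t).trans_eq ?_
  rw [← Finset.mul_sum, Finset.sum_add_distrib]
  simp [mul_comm]

lemma dotProduct_sq_le (v w : Fin p → ℝ) : (v ⬝ᵥ w) ^ 2 ≤ (v ⬝ᵥ v) * (w ⬝ᵥ w) := by
  simpa using sq_dotProduct_mulVec_le Matrix.PosSemidef.one v w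

end Deterministic

section Model

variable {p : ℕ} {Ω : Type*} [MeasurableSpace Ω] {P : Measure Ω} {A S : Matrix (Fin p) (Fin p) ℝ}
  {y e : ℤ → Ω → EuclideanSpace ℝ (Fin p)} {κ₁ κ₂ m : ℝ}

omit [MeasurableSpace Ω] in
lemma norm_sq_design_mulVec (n : ℕ) (ω : Ω) (v : Fin p → ℝ) :
    ‖(WithLp.toLp 2 (design y n ω *ᵥ v) : EuclideanSpace ℝ (Fin n))‖ ^ 2
      = ∑ t : Fin n, (v ⬝ᵥ (y (t : ℕ) ω).ofLp) ^ 2 := by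
  rw [EuclideanSpace.norm_sq_eq]
  refine Finset.sum_congr rfl fun t _ => ?_
  rw [Real.norm_eq_abs, sq_abs]
  congr 1
  exact dotProduct_comm (fun j => (y (t : ℕ) ω).ofLp j) v

omit [MeasurableSpace Ω] in
/-- On the event that the empirical second moments of the truncated process are close to their
expectations and the truncation error is small, the design matrix satisfies the sparse Riesz
condition. -/
lemma sparseRiesz_design (hκ₁ : 0 < κ₁) (hκ₂ : 0 < κ₂) (hm : 0 < m)
    (hd : DependenceBounds κ₁ κ₂ m A S) (hs : IsStable A) {n s : ℕ} (hn : 0 < n) (hs0 : 0 < s)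
    {x : Fin n → Fin p → ℝ} {k : Fin n → ℕ} {ε : ℝ} (hε : 0 ≤ ε) (hε1 : ε ≤ 1)
    (hε2 : ε * (κ₂ / m + κ₁ / 4 + 2) ≤ κ₁ / 4) {ω : Ω}
    (hx : ∀ j l b, |∑ t, (signedPair j l b ⬝ᵥ x t) ^ 2
      - ∑ t, signedPair j l b ⬝ᵥ truncCov A S (k t) *ᵥ signedPair j l b|
        ≤ 2 * (κ₁ * n / (4 * s)))
    (hxy : ∀ t : Fin n, ((y (t : ℕ) ω).ofLp - x t) ⬝ᵥ ((y (t : ℕ) ω).ofLp - x t) ≤ ε ^ 2) :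
    SparseRiesz (design y n ω) s (κ₁ / 2) (κ₂ / m + κ₁ / 2) := by
  intro v hv hv1
  have hn' : (0 : ℝ) < n := by exact_mod_cast hn
  have hs' : (0 : ℝ) < s := by exact_mod_cast hs0
  have hvv : v.ofLp ⬝ᵥ v.ofLp = 1 := by
    have h1 := EuclideanSpace.norm_sq_eq v
    rw [hv1] at h1
    simpa [dotProduct, sq] using h1.symm
  rw [norm_sq_design_mulVec]
  set u := v.ofLp
  have hsymm : ∀ t, (truncCov A S (k t)).IsSymm := fun t => by
    simpa [Matrix.IsSymm] using
      (posSemidef_truncCov (A := A) (posSemidef_noise hκ₁ hd) (k t)).isHermitian.eq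
  have h1 := abs_sum_sq_sub_le hsymm (by positivity) hx u
  have h2 : κ₁ * n / (4 * s) * (l0 u * (u ⬝ᵥ u)) ≤ κ₁ / 4 * n := by
    have hl : (l0 u : ℝ) ≤ s := by exact_mod_cast hv
    rw [hvv, mul_one]
    calc κ₁ * n / (4 * s) * l0 u ≤ κ₁ * n / (4 * s) * s := by gcongr
      _ = κ₁ / 4 * n := by field_simp
  have h3 : κ₁ * n ≤ ∑ t : Fin n, u ⬝ᵥ truncCov A S (k t) *ᵥ u := by
    have := Finset.sum_le_sum (s := Finset.univ) fun (t : Fin n) _ =>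
      le_dotProduct_truncCov hκ₁ hd (k t) u
    rw [hvv] at this
    simp only [Finset.sum_const, Finset.card_univ, Fintype.card_fin, nsmul_eq_mul] at this
    linarith
  have h4 : ∑ t : Fin n, u ⬝ᵥ truncCov A S (k t) *ᵥ u ≤ κ₂ / m * n := by
    have := Finset.sum_le_sum (s := Finset.univ) fun (t : Fin n) _ =>
      dotProduct_truncCov_le hκ₂ hm hs hd (k t) u
    rw [hvv] at this
    simp only [Finset.sum_const, Finset.card_univ, Fintype.card_fin, nsmul_eq_mul] at this
    linarith
  have h5 : ∀ t : Fin n, |u ⬝ᵥ (y (t : ℕ) ω).ofLp - u ⬝ᵥ x t| ≤ ε := by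
    intro t
    rw [← dotProduct_sub]
    refine abs_le_of_sq_le_sq ((dotProduct_sq_le _ _).trans ?_) hε
    rw [hvv, one_mul]; exact hxy t
  have h6 := abs_sum_sq_sub_sum_sq_le hε hε1 h5
  obtain ⟨a1, a2⟩ := abs_le.1 (h1.trans h2)
  have h7 : ε * (∑ t, (u ⬝ᵥ x t) ^ 2 + 2 * n) ≤ κ₁ / 4 * n := by
    calc ε * (∑ t, (u ⬝ᵥ x t) ^ 2 + 2 * n) ≤ ε * ((κ₂ / m + κ₁ / 4 + 2) * n) :=
          mul_le_mul_of_nonneg_left (by linarith) hε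
      _ = ε * (κ₂ / m + κ₁ / 4 + 2) * n := by ring
      _ ≤ _ := mul_le_mul_of_nonneg_right hε2 hn'.le
  obtain ⟨b1, b2⟩ := abs_le.1 (h6.trans h7)
  rw [le_div_iff₀ hn', div_le_iff₀ hn']
  constructor <;> linarith

lemma map_process_eq (h : IsStableGaussianVAR P A S y e) (t : ℤ) : P.map (y t) = P.map (y 0) := by
  have hmy := h.measurable_process
  have h1 := congrArg (fun μ : Measure (ℤ → EuclideanSpace ℝ (Fin p)) => μ.map fun x => x 0)
    (h.stationary t)
  rw [Measure.map_map (measurable_pi_apply 0) (by fun_prop),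
    Measure.map_map (measurable_pi_apply 0) (by fun_prop)] at h1
  simpa [Function.comp_def] using h1

variable [IsProbabilityMeasure P]

/-- The influence of the distant past on the process is negligible: by stationarity, the state at
any time can be replaced by the state at time zero, whose orbit tends to zero. -/
lemma tendsto_measure_pow_mulVec_gt (h : IsStableGaussianVAR P A S y e) (τ : ℕ → ℤ) {η : ℝ}
    (hη : 0 < η) :
    Tendsto (fun k => P.real {ω | η < (A ^ k *ᵥ (y (τ k) ω).ofLp) ⬝ᵥ (A ^ k *ᵥ (y (τ k) ω).ofLp)})
      atTop (𝓝 0) := by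
  set g : ℕ → EuclideanSpace ℝ (Fin p) → ℝ :=
    fun k x => (A ^ k *ᵥ x.ofLp) ⬝ᵥ (A ^ k *ᵥ x.ofLp) with hg
  have hgm : ∀ k, Measurable (g k) := by
    intro k
    have : Continuous (g k) := by
      simp only [hg, dotProduct, Matrix.mulVec]
      fun_prop
    exact this.measurable
  have hlim : TendstoInMeasure P (fun k ω => g k (y 0 ω)) atTop (fun _ => 0) :=
    tendstoInMeasure_of_tendsto_ae
      (fun k => ((hgm k).comp (h.measurable_process 0)).aestronglyMeasurable)
      (ae_of_all _ fun ω => tendsto_pow_mulVec h.stable _)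
  rw [tendstoInMeasure_iff_measureReal_norm] at hlim
  refine squeeze_zero (fun _ => measureReal_nonneg) (fun k => ?_) (hlim η hη)
  have hset : MeasurableSet {x | η < g k x} := measurableSet_lt measurable_const (hgm k)
  have e1 : ∀ t : ℤ, P.real {ω | η < g k (y t ω)} = (P.map (y t)).real {x | η < g k x} := by
    intro t
    rw [map_measureReal_apply (h.measurable_process t) hset]; rfl
  change P.real {ω | η < g k (y (τ k) ω)} ≤ _
  rw [e1, map_process_eq h, ← e1]
  refine measureReal_mono fun ω hω => ?_
  have hω : η < g k (y 0 ω) := hω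
  change η ≤ ‖g k (y 0 ω) - 0‖
  rw [sub_zero]
  exact hω.le.trans (le_abs_self _)

/-- Nonasymptotic bound for the probability that the sparse Riesz condition fails. -/
theorem measure_not_sparseRiesz_le (hκ₁ : 0 < κ₁) (hκ₂ : 0 < κ₂) (hm : 0 < m)
    (hd : DependenceBounds κ₁ κ₂ m A S) (h : IsStableGaussianVAR P A S y e) {n s : ℕ} (hn : 0 < n)
    (hs : 0 < s) :
    P.real {ω | ¬ SparseRiesz (design y n ω) s (κ₁ / 2) (κ₂ / m + κ₁ / 2)}
      ≤ 8 * (p : ℝ) ^ 2 *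
        Real.exp (-(κ₁ / (8 * √(32 * (κ₂ / m) ^ 2 / m)) * (√n / s))) := by
  have hn' : (0 : ℝ) < n := by exact_mod_cast hn
  have hs' : (0 : ℝ) < s := by exact_mod_cast hs
  -- `n * W` bounds the squared Frobenius norm for directions `u` with `u ⬝ᵥ u ≤ 4`
  set W : ℝ := 32 * (κ₂ / m) ^ 2 / m with hW
  have hW0 : 0 < W := by positivity
  -- twice the deviation of an entry (times `n`) that is tolerable for `s`-sparse vectors
  set r : ℝ := 2 * (κ₁ * n / (4 * s)) with hr
  set R : ℝ := Real.exp (-(κ₁ / (8 * √W) * (√n / s))) with hR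
  have hrR : Real.exp (-r / (4 * √(n * W))) = R := by
    rw [hR, hr, Real.sqrt_mul hn'.le]
    congr 1
    have h1 : √(n : ℝ) * √n = n := Real.mul_self_sqrt hn'.le
    have h2 : 0 < √(n : ℝ) := Real.sqrt_pos.2 hn'
    have h3 : 0 < √W := Real.sqrt_pos.2 hW0
    field_simp
    nlinarith
  -- a truncation error that costs at most another `κ₁ / 4`
  set ε : ℝ := min 1 (κ₁ / 4 / (κ₂ / m + κ₁ / 4 + 2)) with hε
  have hε0 : 0 < ε := by positivity
  have hε1 : ε ≤ 1 := min_le_left _ _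
  have hε2 : ε * (κ₂ / m + κ₁ / 4 + 2) ≤ κ₁ / 4 := by
    rw [← le_div_iff₀ (by positivity)]; exact min_le_right _ _
  set Bad : ℕ → Fin p × Fin p × Bool → Set Ω := fun N q => {ω | r ≤
    |∑ t : Fin n, (signedPair q.1 q.2.1 q.2.2 ⬝ᵥ innovationSum A e N (t + N) ω) ^ 2
      - ∑ t : Fin n, signedPair q.1 q.2.1 q.2.2 ⬝ᵥ truncCov A S (t + N) *ᵥ
        signedPair q.1 q.2.1 q.2.2|} with hBad
  set Err : ℕ → Fin n → Set Ω := fun N t => {ω | ε ^ 2 <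
    (A ^ (t + N + 1) *ᵥ (y (-N - 1 : ℤ) ω).ofLp) ⬝ᵥ (A ^ (t + N + 1) *ᵥ (y (-N - 1 : ℤ) ω).ofLp)}
    with hErr
  have hBadle : ∀ N q, P.real (Bad N q) ≤ 4 * R := by
    intro N q
    rw [← hrR]
    refine measure_abs_sum_sq_innovationSum_ge_le hκ₁ hκ₂ hm hd h N n _ (by positivity) ?_
    have h1 := signedPair_dotProduct_self_le q.1 q.2.1 q.2.2
    have h0 : 0 ≤ signedPair q.1 q.2.1 q.2.2 ⬝ᵥ signedPair q.1 q.2.1 q.2.2 := by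
      simpa using dotProduct_star_self_nonneg (signedPair q.1 q.2.1 q.2.2)
    calc _ ≤ 2 * n * ((κ₂ / m) ^ 2 * 4 ^ 2 / m) := by gcongr
      _ = n * W := by rw [hW]; ring
  have hmain : ∀ N, P.real {ω | ¬ SparseRiesz (design y n ω) s (κ₁ / 2) (κ₂ / m + κ₁ / 2)}
      ≤ 8 * (p : ℝ) ^ 2 * R + ∑ t : Fin n, P.real (Err N t) := by
    intro N
    have hae : ∀ᵐ ω ∂P, ω ∈ {ω | ¬ SparseRiesz (design y n ω) s (κ₁ / 2) (κ₂ / m + κ₁ / 2)} →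
        ω ∈ (⋃ q, Bad N q) ∪ ⋃ t, Err N t := by
      have hall := ae_all_iff.2 fun t : Fin n => process_eq_innovationSum_add h N (t + N)
      filter_upwards [hall] with ω hω hbad
      by_contra hcon
      simp only [Set.mem_union, Set.mem_iUnion, not_or, not_exists] at hcon
      refine hbad (sparseRiesz_design (x := fun t => innovationSum A e N (t + N) ω)
        (k := fun t => t + N) hκ₁ hκ₂ hm hd h.stable hn hs hε0.le hε1 hε2
        (fun j l b => ?_) (fun t => ?_))
      · have := hcon.1 (j, l, b)
        exact (not_le.1 this).le
      · have h1 := hω t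
        rw [show (((t : ℕ) + N : ℕ) : ℤ) - N = (t : ℕ) by push_cast; ring] at h1
        rw [h1, add_sub_cancel_left]
        exact not_lt.1 (hcon.2 t)
    calc _ ≤ P.real ((⋃ q, Bad N q) ∪ ⋃ t, Err N t) :=
          ENNReal.toReal_mono (measure_ne_top _ _) (measure_mono_ae hae)
      _ ≤ P.real (⋃ q, Bad N q) + P.real (⋃ t, Err N t) := measureReal_union_le _ _
      _ ≤ ∑ q, P.real (Bad N q) + ∑ t, P.real (Err N t) :=
          add_le_add (measureReal_iUnion_fintype_le _) (measureReal_iUnion_fintype_le _)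
      _ ≤ ∑ _q : Fin p × Fin p × Bool, 4 * R + ∑ t, P.real (Err N t) := by
          gcongr with q; exact hBadle N q
      _ = _ := by
          simp only [Finset.sum_const, Finset.card_univ, Fintype.card_prod, Fintype.card_fin,
            Fintype.card_bool, nsmul_eq_mul]
          push_cast; ring
  -- the left side does not depend on `N`, and the truncation errors vanish as `N → ∞`
  have hlim : Tendsto (fun N => 8 * (p : ℝ) ^ 2 * R + ∑ t : Fin n, P.real (Err N t)) atTop
      (𝓝 (8 * (p : ℝ) ^ 2 * R + ∑ _t : Fin n, 0)) := by
    refine tendsto_const_nhds.add (tendsto_finsetSum _ fun t _ => ?_)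
    -- the number of steps from the initial time to time `t` is reparametrized as `k = t + N + 1`
    have h1 := tendsto_measure_pow_mulVec_gt h (fun k => (t : ℕ) - k) (pow_pos hε0 2)
    have h2 := h1.comp (tendsto_add_atTop_nat ((t : ℕ) + 1))
    refine h2.congr fun N => ?_
    simp only [Function.comp_def, hErr]
    rw [show N + ((t : ℕ) + 1) = t + N + 1 by ring,
      show (((t : ℕ) : ℤ) - ((t + N + 1 : ℕ) : ℤ)) = -N - 1 by push_cast; ring]
  simpa using ge_of_tendsto' hlim hmain

end Model

/-! ### Asymptotics -/

lemma l0_le {p : ℕ} (v : Fin p → ℝ) : l0 v ≤ p := by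
  simpa [l0] using Finset.card_filter_le (Finset.univ : Finset (Fin p)) fun j => v j ≠ 0

lemma SparseRiesz.of_min {n p s : ℕ} {X : Matrix (Fin n) (Fin p) ℝ} {c C : ℝ}
    (h : SparseRiesz X (min s p) c C) : SparseRiesz X s c C :=
  fun v hv hv1 => h v (le_min hv (l0_le _)) hv1

lemma sparseRiesz_zero {n p : ℕ} (X : Matrix (Fin n) (Fin p) ℝ) (c C : ℝ) :
    SparseRiesz X 0 c C := by
  intro v hv hv1
  have h0 : v = 0 := by
    ext j
    by_contra hj
    have : j ∈ Finset.univ.filter fun j => v.ofLp j ≠ 0 := by simpa using hj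
    rw [Finset.card_eq_zero.1 (Nat.le_zero.1 hv)] at this
    simp at this
  simp [h0] at hv1

/-- The exponential tail `exp (-b √n / s)` beats the number `p ^ 2` of entries as soon as
`s (log p + 1) ≤ q √n` with small `q`. -/
lemma sq_mul_exp_le {p s b q x : ℝ} (hp : 1 ≤ p) (hs : 0 < s) (hb : 0 < b) (hq : 0 < q)
    (hqb : 4 * q ≤ b) (h : s * (Real.log p + 1) ≤ q * x) :
    p ^ 2 * Real.exp (-(b * (x / s))) ≤ 2 * q / b := by
  have hlog : 0 ≤ Real.log p := Real.log_nonneg hp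
  have hp2 : p ^ 2 = Real.exp (2 * Real.log p) := by
    rw [two_mul, Real.exp_add, Real.exp_log (by linarith)]; ring
  have h1 : (Real.log p + 1) / q ≤ x / s := by
    rw [div_le_div_iff₀ hq hs]; linarith
  have h2 : 2 * Real.log p + -(b * (x / s)) ≤ -(b / (2 * q)) := by
    have h3 : 2 ≤ b / (2 * q) := by rw [le_div_iff₀ (by positivity)]; linarith
    have h4 : b * ((Real.log p + 1) / q) = 2 * (b / (2 * q)) * (Real.log p + 1) := by
      field_simp
    nlinarith [mul_le_mul_of_nonneg_left h1 hb.le, mul_le_mul_of_nonneg_right h3 hlog]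
  rw [hp2, ← Real.exp_add]
  refine (Real.exp_le_exp.2 h2).trans ?_
  rw [Real.exp_neg, show 2 * q / b = (b / (2 * q))⁻¹ by rw [inv_div]]
  have h5 : 0 < b / (2 * q) := by positivity
  exact inv_anti₀ h5 ((by linarith : b / (2 * q) ≤ b / (2 * q) + 1).trans (Real.add_one_le_exp _))

/-- The sparsity is capped at `p`, since `log p` gives no control of `s` when `p = 1`. -/
lemma min_mul_log_add_one_le {p s : ℕ} (hp : 0 < p) :
    ((min s p : ℕ) : ℝ) * (Real.log p + 1) ≤ 3 * (s * Real.log p) + 1 := by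
  rcases Nat.lt_or_ge p 2 with h | h
  · have hp1 : p = 1 := by omega
    subst hp1
    simp
  · have h2 : Real.log 2 ≤ Real.log p := Real.log_le_log (by norm_num) (by exact_mod_cast h)
    have h3 := Real.log_two_gt_d9
    have h4 : ((min s p : ℕ) : ℝ) ≤ s := by exact_mod_cast min_le_left s p
    calc ((min s p : ℕ) : ℝ) * (Real.log p + 1) ≤ s * (3 * Real.log p) :=
          mul_le_mul h4 (by linarith) (by linarith) (Nat.cast_nonneg _)
      _ ≤ _ := by linarith

/-- The summand `1` in the numerator keeps the quotient positive when the sparsity is zero. -/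
lemma tendsto_effective_dimension {p s t : ℕ → ℕ} (hp : ∀ n, 0 < p n)
    (h : Tendsto (fun n : ℕ => (t n : ℝ) * Real.log (p n) / √(n : ℝ)) atTop (𝓝 0))
    (hO : (fun n => (s n : ℝ)) =O[atTop] fun n => (t n : ℝ)) :
    Tendsto (fun n : ℕ => (((min (s n) (p n) : ℕ) : ℝ) * (Real.log (p n) + 1) + 1) / √(n : ℝ))
      atTop (𝓝 0) := by
  obtain ⟨K, hK⟩ := hO.bound
  have hlog : ∀ n, 0 ≤ Real.log (p n) := fun n => Real.log_natCast_nonneg _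
  have hsqrt : Tendsto (fun n : ℕ => 2 / √(n : ℝ)) atTop (𝓝 0) :=
    tendsto_const_nhds.div_atTop (Real.tendsto_sqrt_atTop.comp tendsto_natCast_atTop_atTop)
  have hup : Tendsto (fun n : ℕ => 3 * K * ((t n : ℝ) * Real.log (p n) / √(n : ℝ)) + 2 / √(n : ℝ))
      atTop (𝓝 0) := by
    simpa using (h.const_mul (3 * K)).add hsqrt
  refine squeeze_zero' (Eventually.of_forall fun n => ?_) ?_ hup
  · have := hlog n; positivity
  · filter_upwards [hK] with n hn
    rw [Real.norm_natCast, Real.norm_natCast] at hn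
    have h1 := min_mul_log_add_one_le (s := s n) (hp n)
    have h2 := mul_le_mul_of_nonneg_right hn (hlog n)
    rw [← mul_div_assoc, ← add_div]
    exact div_le_div_of_nonneg_right (by linarith) (Real.sqrt_nonneg _)

end SparseVAR

theorem mainTheorem4 (κ₁ κ₂ m : ℝ) (hκ₁ : 0 < κ₁) (hκ : κ₁ ≤ κ₂) (hm : 0 < m) :
    ∃ c C : ℝ, 0 < c ∧ c < C ∧
      ∀ (p : ℕ → ℕ) (Ω : ℕ → Type*) [∀ n, MeasurableSpace (Ω n)]
        (P : ∀ n, Measure (Ω n)) [∀ n, IsProbabilityMeasure (P n)]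
        (A S : ∀ n, Matrix (Fin (p n)) (Fin (p n)) ℝ)
        (y e : ∀ n, ℤ → Ω n → EuclideanSpace ℝ (Fin (p n))),
        (∀ n, SparseVAR.DependenceBounds κ₁ κ₂ m (A n) (S n)) →
        (∀ n, SparseVAR.IsStableGaussianVAR (P n) (A n) (S n) (y n) (e n)) →
        ∀ i : ∀ n, Fin (p n),
          Tendsto (fun n : ℕ => (SparseVAR.l0 (A n (i n)) : ℝ) * Real.log (p n) / √(n : ℝ))
            atTop (𝓝 0) →
          ∀ sR : ℕ → ℕ,
            (fun n => (sR n : ℝ)) =O[atTop] (fun n => (SparseVAR.l0 (A n (i n)) : ℝ)) →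
            Tendsto (fun n => P n {ω | SparseVAR.SparseRiesz
                (SparseVAR.design (y n) n ω) (sR n) c C})
              atTop (𝓝 1) := by
  have hκ₂ : 0 < κ₂ := hκ₁.trans_le hκ
  have hL : 0 < κ₂ / m := by positivity
  refine ⟨κ₁ / 2, κ₂ / m + κ₁ / 2, by positivity, by linarith, ?_⟩
  intro p Ω _ P _ A S y e hd hvar i hlim sR hsR
  have hp : ∀ n, 0 < p n := fun n => (i n).pos
  have hq := SparseVAR.tendsto_effective_dimension hp hlim hsR
  set q : ℕ → ℝ := fun n =>
    (((min (sR n) (p n) : ℕ) : ℝ) * (Real.log (p n) + 1) + 1) / √(n : ℝ) with hqdef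
  set b : ℝ := κ₁ / (8 * √(32 * (κ₂ / m) ^ 2 / m)) with hb
  have hb0 : 0 < b := by positivity
  set good : ∀ n, Set (Ω n) := fun n => {ω | SparseVAR.SparseRiesz
    (SparseVAR.design (y n) n ω) (sR n) (κ₁ / 2) (κ₂ / m + κ₁ / 2)} with hgood
  have hbad : ∀ᶠ n in atTop, (P n).real (good n)ᶜ ≤ 8 * (2 * q n / b) := by
    filter_upwards [eventually_gt_atTop 0,
      hq.eventually (gt_mem_nhds (show 0 < b / 4 by positivity))] with n hn hqn
    have hn' : 0 < √(n : ℝ) := Real.sqrt_pos.2 (by exact_mod_cast hn)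
    have hlog : 0 ≤ Real.log (p n) := Real.log_natCast_nonneg _
    have hq0 : 0 < q n := by positivity
    -- the union bound needs `s ≥ 1`, as `log p` is not controlled for sparsity zero
    rcases Nat.eq_zero_or_pos (min (sR n) (p n)) with h0 | hpos
    · have hall : (good n)ᶜ = ∅ := by
        rw [Set.compl_empty_iff, Set.eq_univ_iff_forall]
        intro ω
        apply SparseVAR.SparseRiesz.of_min
        rw [h0]
        exact SparseVAR.sparseRiesz_zero _ _ _
      rw [hall, measureReal_empty]
      positivity
    · have h1 := SparseVAR.measure_not_sparseRiesz_le hκ₁ hκ₂ hm (hd n) (hvar n) hn hpos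
      have hsub : (good n)ᶜ ⊆ {ω | ¬ SparseVAR.SparseRiesz (SparseVAR.design (y n) n ω)
          (min (sR n) (p n)) (κ₁ / 2) (κ₂ / m + κ₁ / 2)} :=
        fun ω hω hcon => hω hcon.of_min
      refine (measureReal_mono hsub).trans (h1.trans ?_)
      rw [mul_assoc]
      refine mul_le_mul_of_nonneg_left ?_ (by norm_num)
      refine SparseVAR.sq_mul_exp_le (by exact_mod_cast hp n) (by exact_mod_cast hpos) hb0 hq0
        (by linarith) ?_
      rw [hqdef]
      simp only
      rw [div_mul_cancel₀ _ hn'.ne']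
      linarith
  have hlow : Tendsto (fun n => 1 - 8 * (2 * q n / b)) atTop (𝓝 1) := by
    simpa using (tendsto_const_nhds (x := (1 : ℝ))).sub (((hq.const_mul 2).div_const b).const_mul 8)
  rw [← ENNReal.tendsto_toReal_iff (fun n => measure_ne_top _ _) ENNReal.one_ne_top,
    ENNReal.toReal_one]
  refine tendsto_of_tendsto_of_tendsto_of_le_of_le' hlow tendsto_const_nhds ?_
    (Eventually.of_forall fun n => measureReal_le_one)
  filter_upwards [hbad] with n hn
  have h1 : (1 : ℝ) ≤ (P n).real (good n) + (P n).real (good n)ᶜ := by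
    rw [← probReal_univ (μ := P n), ← Set.union_compl_self (good n)]
    exact measureReal_union_le _ _
  have h2 : (P n (good n)).toReal = (P n).real (good n) := rfl
  rw [h2]
  linarith
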